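/- Let $\mathfrak g$ be an $n$-dimensional Lie algebra over a field $\boldsymbol k$ of characteristic zero with basis $\hat x_1,\dots,\hat x_n$. Let $\partial^1,\dots,\partial^n$ be the dual basis of $\mathfrak g^*$, and let $\hat S(\mathfrak g^*)=\boldsymbol k[[\partial^1,\dots,\partial^n]]$ be the completed symmetric algebra. Let $\boldsymbol\phi:\mathfrak g\to\operatorname{Der}_{\boldsymbol k}(\hat S(\mathfrak g^*))$ be a homomorphism of Lie algebras, put $\phi^j_i:=\boldsymbol\phi(-\hat x_i)(\partial^j)$, and assume that the matrix $\phi=(\phi^j_i)$ is close to the identity: the constant term of $\phi^j_i$ is $\delta^j_i$ for all $i,j$. In particular $\phi$ is invertible over $\hat S(\mathfrak g^*)$. Write $d\hat x_1,\dots,d\hat x_n$ for the generators of the exterior algebra $\Lambda^*(\mathfrak g)$ that correspond to the basis. Let $\tilde{\boldsymbol\phi}$ be the Lie homomorphism from $\mathfrak g$ to the derivations (ordinary, unsigned Leibniz rule) of $\Lambda^*(\mathfrak g)\otimes\hat S(\mathfrak g^*)$ that extends $\boldsymbol\phi$ and satisfies $$\tilde{\boldsymbol\phi}(-\hat x_i)(d\hat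 x_l)=\sum_{p,s,r} d\hat x_p\,(\phi^{-1})^p_s\,\frac{\partial\phi^s_l}{\partial(\partial^r)}\,\phi^r_i .$$ Extend $\tilde{\boldsymbol\phi}$ to an action of the Hopf algebra $U(\mathfrak g)$, and let $\gamma$ be the antipode of $U(\mathfrak g)$. Let $U(\mathfrak g)\,\sharp\,(\Lambda^*(\mathfrak g)\otimes\hat S(\mathfrak g^*))$ be the smash product algebra for the right Hopf action $\omega\triangleleft u=\tilde{\boldsymbol\phi}(\gamma(u))(\omega)$, that is, the space $U(\mathfrak g)\otimes(\Lambda^*(\mathfrak g)\otimes\hat S(\mathfrak g^*))$ with the product $(u\otimes\omega)(v\otimes\eta)=\sum u v_{(1)}\otimes(\omega\triangleleft v_{(2)})\,\eta$. Let $\hat A_{n,\boldsymbol k}$ be the semicompleted Weyl algebra: the space $S(\mathfrak g)\otimes\hat S(\mathfrak g^*)$ of finite sums of polynomials in commuting variables $x_1,\dots,x_n$ (the basis of $\mathfrak g$ in $S(\mathfrak g)$) times formal power series in the $\partial^i$, with the product determined by $[P,x_j]=\partial P/\partial(\partial^j)$ for $P\in\hat S(\mathfrak g^*)$. Write $dx_1,\dots,dx_n$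 for the generators of $\Lambda^*(\mathfrak g)$ in the ordinary tensor product of algebras $\Lambda^*(\mathfrak g)\otimes\hat A_{n,\boldsymbol k}$. Then there is an isomorphism of $\boldsymbol k$-algebras $$U(\mathfrak g)\,\sharp\,(\Lambda^*(\mathfrak g)\otimes\hat S(\mathfrak g^*))\longrightarrow\Lambda^*(\mathfrak g)\otimes\hat A_{n,\boldsymbol k}$$ such that, for all $i$, $$\hat x_i\mapsto\sum_j x_j\phi^j_i,\qquad \partial^i\mapsto\partial^i,\qquad d\hat x_i\mapsto\sum_j dx_j\,\phi^j_i ,$$ and it is the only homomorphism of $\boldsymbol k$-algebras between these two algebras that takes these values. -/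

import Mathlib

open scoped TensorProduct

noncomputable section

namespace TwistedForms

section Smash

/-- A right Hopf action of a bialgebra `H` on an algebra `A`: a right `H`-module structure
`a ◁ h` with `1 ◁ h = ε(h) 1` and `(a b) ◁ h = ∑ (a ◁ h₁) (b ◁ h₂)`. -/
structure RightHopfAction (k H A : Type*) [CommRing k] [Ring H] [Bialgebra k H] [Ring A]
    [Algebra k A] where
  toAlgHom : H →ₐ[k] (Module.End k A)ᵐᵒᵖ
  one_act' : ∀ h, (toAlgHom h).unop 1 = Coalgebra.counit (R := k) h • (1 : A)
  mul_act' : ∀ h a b, (toAlgHom h).unop (a * b) =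
    LinearMap.mul' k A (TensorProduct.map
      (((MulOpposite.opLinearEquiv k).symm.toLinearMap ∘ₗ toAlgHom.toLinearMap).flip a)
      (((MulOpposite.opLinearEquiv k).symm.toLinearMap ∘ₗ toAlgHom.toLinearMap).flip b)
      (Coalgebra.comul (R := k) h))

variable {k H A : Type*} [CommRing k] [Ring H] [Bialgebra k H] [Ring A] [Algebra k A]

/-- `α.act a h = a ◁ h`. -/
def RightHopfAction.act (α : RightHopfAction k H A) : A →ₗ[k] H →ₗ[k] A :=
  ((MulOpposite.opLinearEquiv k).symm.toLinearMap ∘ₗ α.toAlgHom.toLinearMap).flip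

theorem RightHopfAction.act_apply (α : RightHopfAction k H A) (a : A) (h : H) :
    α.act a h = (α.toAlgHom h).unop a := rfl

theorem RightHopfAction.act_mul (α : RightHopfAction k H A) (a : A) (h h' : H) :
    α.act a (h * h') = α.act (α.act a h) h' := by
  simp [RightHopfAction.act_apply]

theorem RightHopfAction.act_one (α : RightHopfAction k H A) (a : A) : α.act a 1 = a := by
  simp [RightHopfAction.act_apply]

theorem RightHopfAction.one_act (α : RightHopfAction k H A) (h : H) :
    α.act 1 h = Coalgebra.counit (R := k) h • (1 : A) := α.one_act' h

theorem RightHopfAction.mul_act (α : RightHopfAction k H A) (a b : A) (h : H) :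
    α.act (a * b) h =
      LinearMap.mul' k A (TensorProduct.map (α.act a) (α.act b) (Coalgebra.comul (R := k) h)) :=
  α.mul_act' h a b

/-- The smash product `H ♯ A` of a bialgebra `H` with a right `H`-module algebra `A`. Its
underlying module is `H ⊗ A`. -/
def Smash (_α : RightHopfAction k H A) : Type _ := H ⊗[k] A

namespace Smash

variable (α : RightHopfAction k H A)

instance : AddCommGroup (Smash α) := inferInstanceAs (AddCommGroup (H ⊗[k] A))

instance : Module k (Smash α) := inferInstanceAs (Module k (H ⊗[k] A))

/-- The multiplication `(u ⊗ a) (v ⊗ b) = ∑ u v₁ ⊗ (a ◁ v₂) b` on `H ⊗ A`. -/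
def mulMap : H ⊗[k] A →ₗ[k] H ⊗[k] A →ₗ[k] H ⊗[k] A :=
  TensorProduct.lift <| LinearMap.mk₂ k
    (fun u a => TensorProduct.lift <| LinearMap.mk₂ k
      (fun v b => TensorProduct.map (LinearMap.mul k H u) ((LinearMap.mul k A).flip b ∘ₗ α.act a)
        (Coalgebra.comul (R := k) v))
      (fun v v' b => by simp)
      (fun c v b => by simp)
      (fun v b b' => by simp [LinearMap.add_comp, TensorProduct.map_add_right])
      (fun c v b => by simp [LinearMap.smul_comp, TensorProduct.map_smul_right]))
    (fun u u' a => by ext v b; simp [TensorProduct.map_add_left])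
    (fun c u a => by ext v b; simp [TensorProduct.map_smul_left])
    (fun u a a' => by ext v b; simp [LinearMap.comp_add, TensorProduct.map_add_right])
    (fun c u a => by ext v b; simp [LinearMap.comp_smul, TensorProduct.map_smul_right])

theorem mulMap_tmul (u v : H) (a b : A) :
    mulMap α (u ⊗ₜ a) (v ⊗ₜ b) =
      TensorProduct.map (LinearMap.mul k H u) ((LinearMap.mul k A).flip b ∘ₗ α.act a)
        (Coalgebra.comul (R := k) v) := rfl

theorem mulMap_one_right (x : H ⊗[k] A) : mulMap α x (1 ⊗ₜ 1) = x := by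
  induction x with
  | zero => simp
  | add x y hx hy => simp [hx, hy]
  | tmul u a => simp [mulMap_tmul, Algebra.TensorProduct.one_def, α.act_one]

theorem mulMap_one_left (x : H ⊗[k] A) : mulMap α (1 ⊗ₜ 1) x = x := by
  induction x with
  | zero => simp
  | add x y hx hy => simp [hx, hy]
  | tmul v b =>
    have h1 : ((LinearMap.mul k A).flip b ∘ₗ α.act 1 : H →ₗ[k] A) =
        (LinearMap.toSpanSingleton k A b) ∘ₗ Coalgebra.counit := by
      ext h; simp [α.one_act]
    have h2 : LinearMap.mul k H (1 : H) = LinearMap.id := by ext; simp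
    rw [mulMap_tmul, h1, h2]
    have h3 := Coalgebra.lTensor_counit_comul (R := k) v
    have h4 := congrArg (TensorProduct.map LinearMap.id (LinearMap.toSpanSingleton k A b)) h3
    rw [TensorProduct.map_tmul] at h4
    rw [← LinearMap.comp_apply] at h4
    rw [LinearMap.lTensor, ← TensorProduct.map_comp] at h4
    simpa using h4

/-- `t ⊗ s ⊗ q ↦ (u ⊗ a) ◁ (t s)`, multiplied on the right by `(b ◁ q) c`. -/
def assocAux (u : H) (a b c : A) : H ⊗[k] H →ₗ[k] (H ⊗[k] H) ⊗[k] H →ₗ[k] H ⊗[k] A :=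
  LinearMap.mk₂ k
    (fun t r => TensorProduct.lift (LinearMap.mk₂ k
      (fun (s : H ⊗[k] H) (q : H) => TensorProduct.map (LinearMap.mul k H u)
        ((LinearMap.mul k A).flip (α.act b q * c) ∘ₗ α.act a) (t * s))
      (fun s s' q => by simp only [mul_add, map_add])
      (fun r s q => by simp only [mul_smul_comm, map_smul])
      (fun s q q' => by
        simp only [map_add, add_mul, LinearMap.add_comp, TensorProduct.map_add_right,
          LinearMap.add_apply])
      (fun r s q => by
        simp only [map_smul, smul_mul_assoc, LinearMap.smul_comp, TensorProduct.map_smul_right,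
          LinearMap.smul_apply])) r)
    (fun t t' r => by
      induction r with
      | zero => simp
      | add x y hx hy => simp only [map_add, hx, hy]; abel
      | tmul x y => simp only [TensorProduct.lift.tmul, LinearMap.mk₂_apply, add_mul, map_add])
    (fun z t r => by
      induction r with
      | zero => simp
      | add x y hx hy => simp only [map_add, hx, hy, smul_add]
      | tmul x y =>
        simp only [TensorProduct.lift.tmul, LinearMap.mk₂_apply, smul_mul_assoc, map_smul])
    (fun t r r' => map_add _ _ _)
    (fun z t r => map_smul _ _ _)

theorem assocAux_tmul (u : H) (a b c : A) (t s : H ⊗[k] H) (q : H) :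
    assocAux α u a b c t (s ⊗ₜ q) = TensorProduct.map (LinearMap.mul k H u)
        ((LinearMap.mul k A).flip (α.act b q * c) ∘ₗ α.act a) (t * s) := rfl

theorem assocAux_left (u w : H) (a b c : A) (t : H ⊗[k] H) :
    mulMap α (TensorProduct.map (LinearMap.mul k H u) ((LinearMap.mul k A).flip b ∘ₗ α.act a) t)
        (w ⊗ₜ c) =
      assocAux α u a b c t
        (LinearMap.rTensor H Coalgebra.comul (Coalgebra.comul (R := k) w)) := by
  rw [← (TensorProduct.assoc k H H H).symm_apply_apply (LinearMap.rTensor H _ _),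
    Coalgebra.coassoc_apply]
  induction t with
  | zero => simp only [map_zero, LinearMap.zero_apply]
  | add t t' ht ht' => simp only [map_add, LinearMap.add_apply, ht, ht']
  | tmul p q =>
    rw [TensorProduct.map_tmul, mulMap_tmul]
    generalize Coalgebra.comul (R := k) w = r
    induction r with
    | zero => simp only [map_zero]
    | add x y hx hy => simp only [map_add, hx, hy]
    | tmul w₁ w₂ =>
      simp only [TensorProduct.map_tmul, LinearMap.lTensor_tmul, LinearMap.comp_apply,
        LinearMap.flip_apply, LinearMap.mul_apply', α.mul_act]
      generalize Coalgebra.comul (R := k) w₂ = r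
      induction r with
      | zero => simp
      | add x y hx hy =>
        simp only [map_add, TensorProduct.tmul_add, add_mul, hx, hy]
      | tmul x y =>
        simp only [TensorProduct.assoc_symm_tmul, assocAux_tmul, TensorProduct.map_tmul,
          LinearMap.mul'_apply, Algebra.TensorProduct.tmul_mul_tmul, LinearMap.comp_apply,
          LinearMap.flip_apply, LinearMap.mul_apply', α.act_mul, mul_assoc]

theorem assocAux_right (u v w : H) (a b c : A) :
    mulMap α (u ⊗ₜ a) (mulMap α (v ⊗ₜ b) (w ⊗ₜ c)) =
      assocAux α u a b c (Coalgebra.comul (R := k) v)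
        (LinearMap.rTensor H Coalgebra.comul (Coalgebra.comul (R := k) w)) := by
  rw [mulMap_tmul α v w]
  generalize Coalgebra.comul (R := k) w = r
  induction r with
  | zero => simp only [map_zero]
  | add x y hx hy => simp only [map_add, hx, hy]
  | tmul w₁ w₂ =>
    simp only [TensorProduct.map_tmul, mulMap_tmul, LinearMap.rTensor_tmul, assocAux_tmul,
      LinearMap.comp_apply, LinearMap.flip_apply, LinearMap.mul_apply', Bialgebra.comul_mul]

theorem mulMap_assoc (x y z : H ⊗[k] A) :
    mulMap α (mulMap α x y) z = mulMap α x (mulMap α y z) := by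
  induction x with
  | zero => simp only [map_zero, LinearMap.zero_apply]
  | add x x' hx hx' => simp only [map_add, LinearMap.add_apply, hx, hx']
  | tmul u a =>
  induction y with
  | zero => simp only [map_zero, LinearMap.zero_apply]
  | add x x' hx hx' => simp only [map_add, LinearMap.add_apply, hx, hx']
  | tmul v b =>
  induction z with
  | zero => simp only [map_zero]
  | add x x' hx hx' => simp only [map_add, hx, hx']
  | tmul w c => rw [assocAux_right, mulMap_tmul α u v, assocAux_left]

instance : Ring (Smash α) where
  __ := (inferInstance : AddCommGroup (Smash α))
  mul x y := mulMap α x y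
  one := ((1 : H) ⊗ₜ[k] (1 : A) : H ⊗[k] A)
  mul_assoc := mulMap_assoc α
  one_mul := mulMap_one_left α
  mul_one := mulMap_one_right α
  left_distrib x y z := (mulMap α x).map_add y z
  right_distrib x y z := (mulMap α).map_add₂ x y z
  zero_mul := (mulMap α).map_zero₂
  mul_zero x := (mulMap α x).map_zero

instance : Algebra k (Smash α) :=
  Algebra.ofModule (fun r x y => (mulMap α).map_smul₂ r x y)
    (fun r x y => (mulMap α x).map_smul r y)

/-- The element `u ⊗ a` of `H ♯ A`. -/
def tmul (u : H) (a : A) : Smash α := (u ⊗ₜ[k] a : H ⊗[k] A)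

theorem mul_def (x y : Smash α) : x * y = mulMap α x y := rfl

theorem one_def : (1 : Smash α) = tmul α 1 1 := rfl

/-- The inclusion `H → H ♯ A`, `u ↦ u ⊗ 1`. -/
def inl : H →ₐ[k] Smash α :=
  AlgHom.ofLinearMap ((TensorProduct.mk k H A).flip 1) rfl fun u v => by
    change (u * v) ⊗ₜ[k] (1 : A) = mulMap α (u ⊗ₜ 1) (v ⊗ₜ 1)
    have h1 : ((LinearMap.mul k A).flip 1 ∘ₗ α.act 1 : H →ₗ[k] A) =
        (LinearMap.toSpanSingleton k A 1) ∘ₗ Coalgebra.counit := by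
      ext h; simp [α.one_act]
    have h3 := Coalgebra.lTensor_counit_comul (R := k) v
    have h4 := congrArg
      (TensorProduct.map (LinearMap.mul k H u) (LinearMap.toSpanSingleton k A 1)) h3
    rw [TensorProduct.map_tmul, ← LinearMap.comp_apply, LinearMap.lTensor,
      ← TensorProduct.map_comp] at h4
    rw [mulMap_tmul, h1]
    simpa using h4.symm

/-- The inclusion `A → H ♯ A`, `a ↦ 1 ⊗ a`. -/
def inr : A →ₐ[k] Smash α :=
  AlgHom.ofLinearMap (TensorProduct.mk k H A 1) rfl fun a b => by
    change (1 : H) ⊗ₜ[k] (a * b) = mulMap α (1 ⊗ₜ a) (1 ⊗ₜ b)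
    simp [mulMap_tmul, Algebra.TensorProduct.one_def, α.act_one]

end Smash

/-- A right action of a bialgebra generated by primitive elements is a right Hopf action as soon
as the generators act by derivations. -/
def RightHopfAction.ofPrimitive (f : H →ₐ[k] (Module.End k A)ᵐᵒᵖ) (G : Set H)
    (hG : Algebra.adjoin k G = ⊤)
    (hΔ : ∀ x ∈ G, Coalgebra.comul (R := k) x = x ⊗ₜ 1 + 1 ⊗ₜ x)
    (hε : ∀ x ∈ G, Coalgebra.counit (R := k) x = 0)
    (hd : ∀ x ∈ G, ∀ a b : A, (f x).unop (a * b) = (f x).unop a * b + a * (f x).unop b) :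
    RightHopfAction k H A where
  toAlgHom := f
  one_act' h := by
    have hh : h ∈ Algebra.adjoin k G := hG ▸ Algebra.mem_top
    induction hh using Algebra.adjoin_induction with
    | mem x hx =>
      have := hd x hx 1 1
      simp only [mul_one, one_mul, left_eq_add] at this
      simp [hε x hx, this]
    | algebraMap r => simp [Algebra.algebraMap_eq_smul_one]
    | add x y _ _ hx hy => simp [hx, hy, add_smul]
    | mul x y _ _ hx hy => simp [hx, hy, smul_smul]
  mul_act' h := by
    have hh : h ∈ Algebra.adjoin k G := hG ▸ Algebra.mem_top
    induction hh using Algebra.adjoin_induction with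
    | mem x hx => intro a b; simp [hΔ x hx, hd x hx]
    | algebraMap r =>
      intro a b; simp [Algebra.algebraMap_eq_smul_one, Algebra.TensorProduct.one_def]
    | add x y _ _ hx hy => intro a b; simp [hx, hy]
    | mul x y _ _ hx hy =>
      intro a b
      rw [map_mul f, MulOpposite.unop_mul, Module.End.mul_apply, hx, Bialgebra.comul_mul]
      generalize Coalgebra.comul (R := k) x = r
      induction r with
      | zero => simp
      | add x y hx hy => simp only [map_add, add_mul, hx, hy]
      | tmul p q =>
        simp only [TensorProduct.map_tmul, LinearMap.mul'_apply]
        rw [hy]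
        generalize Coalgebra.comul (R := k) y = r
        induction r with
        | zero => simp
        | add x y hx hy => simp only [map_add, mul_add, hx, hy]
        | tmul p q => simp

end Smash

section Enveloping

attribute [local instance 100] LieRing.ofAssociativeRing

variable (k g : Type*) [Field k] [LieRing g] [LieAlgebra k g]

/-- The comultiplication of `U(g)`, for which the elements of `g` are primitive. -/
def comulU : UniversalEnvelopingAlgebra k g →ₐ[k]
    UniversalEnvelopingAlgebra k g ⊗[k] UniversalEnvelopingAlgebra k g :=
  UniversalEnvelopingAlgebra.lift k
    { toFun x := UniversalEnvelopingAlgebra.ι k x ⊗ₜ 1 + 1 ⊗ₜ UniversalEnvelopingAlgebra.ι k x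
      map_add' x y := by
        simp only [map_add, TensorProduct.add_tmul, TensorProduct.tmul_add]; abel
      map_smul' c x := by
        simp only [map_smul, TensorProduct.tmul_smul, TensorProduct.smul_tmul', smul_add,
          RingHom.id_apply]
      map_lie' {x y} := by
        simp only [LieHom.map_lie, LieRing.of_associative_ring_bracket, add_mul, mul_add,
          TensorProduct.sub_tmul, TensorProduct.tmul_sub,
          Algebra.TensorProduct.tmul_mul_tmul, mul_one, one_mul]
        abel }

/-- The counit of `U(g)`, which vanishes on `g`. -/
def counitU : UniversalEnvelopingAlgebra k g →ₐ[k] k :=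
  UniversalEnvelopingAlgebra.lift k
    { (0 : g →ₗ[k] k) with map_lie' {x y} := by simp }

theorem comulU_ι (x : g) : comulU k g (UniversalEnvelopingAlgebra.ι k x) =
    UniversalEnvelopingAlgebra.ι k x ⊗ₜ 1 + 1 ⊗ₜ UniversalEnvelopingAlgebra.ι k x :=
  UniversalEnvelopingAlgebra.lift_ι_apply k _ x

theorem counitU_ι (x : g) : counitU k g (UniversalEnvelopingAlgebra.ι k x) = 0 :=
  UniversalEnvelopingAlgebra.lift_ι_apply k _ x

theorem algHomU_ext {B : Type*} [Ring B] [Algebra k B]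
    {f f' : UniversalEnvelopingAlgebra k g →ₐ[k] B}
    (h : ∀ x, f (UniversalEnvelopingAlgebra.ι k x) = f' (UniversalEnvelopingAlgebra.ι k x)) :
    f = f' :=
  UniversalEnvelopingAlgebra.hom_ext k (LieHom.ext h)

instance bialgebraU : Bialgebra k (UniversalEnvelopingAlgebra k g) :=
  .ofAlgHom (comulU k g) (counitU k g)
    (algHomU_ext k g fun x => by
      change Algebra.TensorProduct.assoc k k k _ _ _
        (Algebra.TensorProduct.map _ _ (comulU k g _)) =
          Algebra.TensorProduct.map _ _ (comulU k g _)
      simp only [comulU_ι, map_add, Algebra.TensorProduct.map_tmul, map_one,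
        AlgHom.id_apply, TensorProduct.add_tmul, TensorProduct.tmul_add,
        Algebra.TensorProduct.one_def, Algebra.TensorProduct.assoc_tmul]
      abel)
    (algHomU_ext k g fun x => by
      change Algebra.TensorProduct.map _ _ (comulU k g _) = _
      simp only [comulU_ι, counitU_ι, map_add, Algebra.TensorProduct.map_tmul, map_one,
        AlgHom.id_apply, TensorProduct.zero_tmul, zero_add]
      rfl)
    (algHomU_ext k g fun x => by
      change Algebra.TensorProduct.map _ _ (comulU k g _) = _
      simp only [comulU_ι, counitU_ι, map_add, Algebra.TensorProduct.map_tmul, map_one,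
        AlgHom.id_apply, TensorProduct.tmul_zero, add_zero]
      rfl)

/-- The antipode `γ : U(g) → U(g)ᵒᵖ`, with `γ(x) = -x` for `x` in `g`. -/
def antipodeU : UniversalEnvelopingAlgebra k g →ₐ[k] (UniversalEnvelopingAlgebra k g)ᵐᵒᵖ :=
  UniversalEnvelopingAlgebra.lift k
    { toFun x := MulOpposite.op (-UniversalEnvelopingAlgebra.ι k x)
      map_add' x y := by simp only [map_add, neg_add, MulOpposite.op_add]
      map_smul' c x := by simp only [map_smul, ← smul_neg, MulOpposite.op_smul, RingHom.id_apply]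
      map_lie' {x y} := by
        simp only [LieHom.map_lie, LieRing.of_associative_ring_bracket, ← MulOpposite.op_mul,
          ← MulOpposite.op_sub, neg_mul_neg, neg_sub] }

theorem antipodeU_ι (x : g) : antipodeU k g (UniversalEnvelopingAlgebra.ι k x) =
    MulOpposite.op (-UniversalEnvelopingAlgebra.ι k x) :=
  UniversalEnvelopingAlgebra.lift_ι_apply k _ x

theorem adjoin_range_ιU :
    Algebra.adjoin k (Set.range (UniversalEnvelopingAlgebra.ι k : g → _)) = ⊤ := by
  set B := Algebra.adjoin k (Set.range (UniversalEnvelopingAlgebra.ι k : g → _)) with hB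
  let f : UniversalEnvelopingAlgebra k g →ₐ[k] B := UniversalEnvelopingAlgebra.lift k
    { toFun x := ⟨UniversalEnvelopingAlgebra.ι k x, Algebra.subset_adjoin ⟨x, rfl⟩⟩
      map_add' x y := Subtype.ext (map_add _ x y)
      map_smul' c x := Subtype.ext (map_smul _ c x)
      map_lie' {x y} := Subtype.ext (by
        simp [LieHom.map_lie, LieRing.of_associative_ring_bracket]) }
  have hf : B.val.comp f = AlgHom.id k _ := algHomU_ext k g fun x => by
    rw [AlgHom.comp_apply, UniversalEnvelopingAlgebra.lift_ι_apply]; rfl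
  refine top_le_iff.1 fun u _ => ?_
  have := DFunLike.congr_fun hf u
  rw [AlgHom.id_apply] at this
  rw [← this]
  exact (f u).2

variable {k g}

/-- The right Hopf action `a ◁ u = ψ(γ(u))(a)` of `U(g)` on an algebra `A`, where `ψ` is the left
action of `U(g)` extending a representation of `g` by derivations of `A`. -/
def rightActionU {A : Type*} [Ring A] [Algebra k A] (ψ : g →ₗ⁅k⁆ Module.End k A)
    (hψ : ∀ x a b, ψ x (a * b) = ψ x a * b + a * ψ x b) :
    RightHopfAction k (UniversalEnvelopingAlgebra k g) A :=
  .ofPrimitive ((AlgHom.op (UniversalEnvelopingAlgebra.lift k ψ)).comp (antipodeU k g))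
    (Set.range (UniversalEnvelopingAlgebra.ι k : g → _)) (adjoin_range_ιU k g)
    (by rintro _ ⟨x, rfl⟩; exact comulU_ι k g x)
    (by rintro _ ⟨x, rfl⟩; exact counitU_ι k g x)
    (by
      rintro _ ⟨x, rfl⟩ a b
      have h : (AlgHom.op (UniversalEnvelopingAlgebra.lift k ψ)).comp (antipodeU k g)
          (UniversalEnvelopingAlgebra.ι k x) = MulOpposite.op (-ψ x) := by
        rw [AlgHom.comp_apply, antipodeU_ι, ← UniversalEnvelopingAlgebra.lift_ι_apply k ψ x,
          ← map_neg (UniversalEnvelopingAlgebra.lift k ψ)]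
        rfl
      rw [h]
      simp [hψ]
      abel)

end Enveloping

section Symmetric

variable {k V B : Type*} [Field k] [AddCommGroup V] [Module k V] [Ring B] [Algebra k B]

/-- A linear map into an algebra with commuting values extends to the symmetric algebra. -/
def liftSym (f : V →ₗ[k] B) (hf : ∀ x y, f x * f y = f y * f x) : SymmetricAlgebra k V →ₐ[k] B :=
  let S := Algebra.adjoin k (Set.range f)
  letI : CommSemiring S :=
    { S.toSemiring with
      mul_comm := (Algebra.isMulCommutative_adjoin k
        (by rintro _ ⟨x, rfl⟩ _ ⟨y, rfl⟩; exact hf x y)).is_comm.comm }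
  letI : Algebra k S := S.algebra
  S.val.comp (SymmetricAlgebra.lift (LinearMap.codRestrict (Subalgebra.toSubmodule S) f
    fun x => Algebra.subset_adjoin ⟨x, rfl⟩))

theorem liftSym_ι (f : V →ₗ[k] B) (hf : ∀ x y, f x * f y = f y * f x) (x : V) :
    liftSym f hf (SymmetricAlgebra.ι k V x) = f x := by
  exact congrArg Subtype.val (@SymmetricAlgebra.lift_ι_apply k V _ _ _ _ (_) (_) _ x)

theorem adjoin_range_ιSym :
    Algebra.adjoin k (Set.range (SymmetricAlgebra.ι k V)) = ⊤ := by
  refine top_le_iff.1 fun u _ => ?_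
  induction u using SymmetricAlgebra.induction with
  | algebraMap r => exact Subalgebra.algebraMap_mem _ r
  | ι x => exact Algebra.subset_adjoin ⟨x, rfl⟩
  | mul a b ha hb => exact Subalgebra.mul_mem _ (ha trivial) (hb trivial)
  | add a b ha hb => exact Subalgebra.add_mem _ (ha trivial) (hb trivial)

end Symmetric

section PowerSeries

/-- `Ŝ(g*)`: formal power series in the dual basis `∂¹, …, ∂ⁿ` of `g*`. -/
abbrev SHat (k : Type*) [Field k] (n : ℕ) : Type _ := MvPowerSeries (Fin n) k

variable {k : Type*} [Field k] {n : ℕ}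

theorem pderiv_comm (i j : Fin n) (f : SHat k n) :
    MvPowerSeries.pderiv k i (MvPowerSeries.pderiv k j f) =
      MvPowerSeries.pderiv k j (MvPowerSeries.pderiv k i f) := by
  rcases eq_or_ne i j with rfl | h
  · rfl
  ext d
  simp only [MvPowerSeries.coeff_pderiv, Finsupp.add_apply, Finsupp.single_eq_of_ne h,
    Finsupp.single_eq_of_ne h.symm, add_zero]
  rw [add_right_comm]
  ring

theorem exists_eq_C_add_sum (f : SHat k n) : ∃ q : Fin n → SHat k n,
    f = MvPowerSeries.C (MvPowerSeries.constantCoeff f) + ∑ i, MvPowerSeries.X i * q i := by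
  classical
  -- the monomials that contain a variable are distributed according to their first variable
  let P : Fin n → (Fin n →₀ ℕ) → Prop := fun i d => d i ≠ 0 ∧ ∀ j < i, d j = 0
  let q : Fin n → SHat k n := fun i d => if P i (d + Finsupp.single i 1) then
    MvPowerSeries.coeff (d + Finsupp.single i 1) f else 0
  have hq : ∀ i d, MvPowerSeries.coeff d (q i) = if P i (d + Finsupp.single i 1) then
    MvPowerSeries.coeff (d + Finsupp.single i 1) f else 0 := fun i d => rfl
  refine ⟨q, ?_⟩
  have hX : ∀ (i : Fin n) (q : SHat k n) (d : Fin n →₀ ℕ),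
      MvPowerSeries.coeff d (MvPowerSeries.X i * q) =
        if d i ≠ 0 then MvPowerSeries.coeff (d - Finsupp.single i 1) q else 0 := by
    intro i q d
    rw [MvPowerSeries.X, MvPowerSeries.coeff_monomial_mul]
    simp [Nat.one_le_iff_ne_zero]
  ext d
  rw [map_add, map_sum, MvPowerSeries.coeff_C]
  simp only [hX, hq]
  by_cases hd : d = 0
  · subst hd; simp
  rw [if_neg hd, zero_add]
  have hne : ∃ i, d i ≠ 0 := by
    by_contra! h
    exact hd (Finsupp.ext h)
  obtain ⟨i, hi, hmin⟩ : ∃ i, d i ≠ 0 ∧ ∀ j < i, d j = 0 := by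
    obtain ⟨i, hi, hm⟩ := WellFounded.has_min (wellFounded_lt (α := Fin n)) {i | d i ≠ 0} hne
    exact ⟨i, hi, fun j hj => by by_contra h; exact hm j h hj⟩
  have hco : ∀ j, d j ≠ 0 → d - Finsupp.single j 1 + Finsupp.single j 1 = d := fun j hj =>
    tsub_add_cancel_of_le (by simpa [Nat.one_le_iff_ne_zero] using hj)
  rw [Finset.sum_eq_single i]
  · rw [if_pos hi]
    rw [hco i hi, if_pos ⟨hi, hmin⟩]
  · intro j _ hji
    by_cases hj : d j ≠ 0
    · rw [if_pos hj, hco j hj, if_neg]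
      rintro ⟨_, h⟩
      rcases lt_or_gt_of_ne hji with h' | h'
      · exact hj (hmin j h')
      · exact hi (h i h')
    · rw [if_neg hj]
  · simp

theorem derivation_eq_zero (D : Derivation k (SHat k n) (SHat k n))
    (hD : ∀ i, D (MvPowerSeries.X i) = 0) (f : SHat k n) : D f = 0 := by
  have h : ∀ (N : ℕ) (f : SHat k n) (d : Fin n →₀ ℕ), d.degree < N →
      MvPowerSeries.coeff d (D f) = 0 := by
    intro N
    induction N with
    | zero => intro f d h; exact absurd h (Nat.not_lt_zero _)
    | succ N ih =>
      intro f d hd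
      obtain ⟨q, hq⟩ := exists_eq_C_add_sum f
      rw [hq, map_add, map_sum, map_add, map_sum]
      have hC : D (MvPowerSeries.C (MvPowerSeries.constantCoeff f)) = 0 := D.map_algebraMap _
      rw [hC, map_zero, zero_add]
      refine Finset.sum_eq_zero fun i _ => ?_
      rw [D.leibniz, hD, smul_zero, add_zero, smul_eq_mul, MvPowerSeries.X,
        MvPowerSeries.coeff_monomial_mul]
      split_ifs with hi
      · rw [ih, mul_zero]
        have h1 : (d - Finsupp.single i 1 + Finsupp.single i 1).degree = d.degree := by
          rw [tsub_add_cancel_of_le hi]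
        rw [map_add, Finsupp.degree_single] at h1
        omega
      · rfl
  ext d
  rw [h (d.degree + 1) f d (Nat.lt_succ_self _), map_zero]

theorem derivation_chain_rule (D : Derivation k (SHat k n) (SHat k n)) (f : SHat k n) :
    D f = ∑ r, MvPowerSeries.pderiv k r f * D (MvPowerSeries.X r) := by
  classical
  have hs : ∀ f, (∑ r, D (MvPowerSeries.X r) • MvPowerSeries.pderiv k r) f =
      ∑ r, MvPowerSeries.pderiv k r f * D (MvPowerSeries.X r) := fun f => by
    rw [← Derivation.coeFnAddMonoidHom_apply, map_sum, Finset.sum_apply]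
    simp [mul_comm]
  have h := derivation_eq_zero (D - ∑ r, D (MvPowerSeries.X r) • MvPowerSeries.pderiv k r)
    (fun i => by
      simp [Derivation.sub_apply, hs, MvPowerSeries.pderiv_X, Pi.single_apply]) f
  rwa [Derivation.sub_apply, sub_eq_zero, hs] at h

end PowerSeries

section Weyl

variable {k g : Type*} [Field k] [AddCommGroup g] [Module k g] {n : ℕ}
  (b : Module.Basis (Fin n) k g)

/-- The linear map from `g` to the derivations of `Ŝ(g*)` sending `x_j` to `∂/∂(∂^j)`. -/
def dirDeriv : g →ₗ[k] (Module.End k (SHat k n))ᵐᵒᵖ :=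
  b.constr k fun j => MulOpposite.op (MvPowerSeries.pderiv k j).toLinearMap

theorem dirDeriv_apply (x : g) (f : SHat k n) :
    (dirDeriv b x).unop f = ∑ j, b.repr x j • MvPowerSeries.pderiv k j f := by
  simp [dirDeriv, Module.Basis.constr_apply_fintype]

theorem dirDeriv_comm (x y : g) : dirDeriv b x * dirDeriv b y = dirDeriv b y * dirDeriv b x :=
  MulOpposite.unop_injective <| LinearMap.ext fun f => by
    simp only [MulOpposite.unop_mul, Module.End.mul_apply, dirDeriv_apply, map_sum,
      Derivation.map_smul]
    rw [Finset.sum_comm]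
    refine Finset.sum_congr rfl fun i _ => Finset.sum_congr rfl fun j _ => ?_
    rw [pderiv_comm, smul_comm]

/-- The right Hopf action of `S(g)` on `Ŝ(g*)` by constant coefficient differential operators,
in which `x_j` acts by `∂/∂(∂^j)`. -/
def weylAction : RightHopfAction k (SymmetricAlgebra k g) (SHat k n) :=
  .ofPrimitive (liftSym (dirDeriv b) (dirDeriv_comm b))
    (Set.range (SymmetricAlgebra.ι k g)) adjoin_range_ιSym
    (by rintro _ ⟨x, rfl⟩; exact SymmetricAlgebra.comul_ι k g x)
    (by rintro _ ⟨x, rfl⟩; exact SymmetricAlgebra.counit_ι k g x)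
    (by
      rintro _ ⟨x, rfl⟩ f h
      simp only [liftSym_ι, dirDeriv_apply, Derivation.leibniz, smul_eq_mul, smul_add,
        Finset.sum_add_distrib, Finset.sum_mul, Finset.mul_sum, smul_mul_assoc, mul_smul_comm]
      rw [add_comm]
      congr 1
      exact Finset.sum_congr rfl fun i _ => by rw [mul_comm])

/-- The semicompleted Weyl algebra `Â_n = S(g) ♯ Ŝ(g*)`: its underlying vector space is
`S(g) ⊗ Ŝ(g*)`, its elements are finite sums of a polynomial in `x_1, …, x_n` times a formal power
series in `∂¹, …, ∂ⁿ`, and `[P, x_j] = ∂P/∂(∂^j)` for `P` in `Ŝ(g*)`. -/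
abbrev WeylHat : Type _ := Smash (weylAction b)

/-- The generator `x_j` of `Â_n`. -/
def WeylHat.x (j : Fin n) : WeylHat b :=
  Smash.inl (weylAction b) (SymmetricAlgebra.ι k g (b j))

/-- The inclusion of the power series in the derivatives `∂¹, …, ∂ⁿ` into `Â_n`. -/
def WeylHat.ofSeries : SHat k n →ₐ[k] WeylHat b := Smash.inr (weylAction b)

/-- The generator `∂^i` of `Â_n`. -/
def WeylHat.del (i : Fin n) : WeylHat b := WeylHat.ofSeries b (MvPowerSeries.X i)

end Weyl

section Forms

attribute [local instance 100] LieRing.ofAssociativeRing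

/-- `Λ(g) ⊗ Ŝ(g*)`. -/
abbrev FormSeries (k g : Type*) [Field k] [AddCommGroup g] [Module k g] (n : ℕ) : Type _ :=
  ExteriorAlgebra k g ⊗[k] SHat k n

variable {k g : Type*} [Field k] [LieRing g] [LieAlgebra k g] {n : ℕ}

/-- The operator `ω ↦ v ∧ (d ⌋ ω)` on `Λ(g)`: the derivation of degree zero of `Λ(g)` that sends
a vector `w` to `d(w) v`. -/
def wedgeContract (v : g) (d : Module.Dual k g) : Module.End k (ExteriorAlgebra k g) :=
  LinearMap.mulLeft k (ExteriorAlgebra.ι k v) ∘ₗ CliffordAlgebra.contractLeft d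

theorem wedgeContract_ι (v w : g) (d : Module.Dual k g) :
    wedgeContract v d (ExteriorAlgebra.ι k w) = d w • ExteriorAlgebra.ι k v := by
  have h : CliffordAlgebra.contractLeft d (ExteriorAlgebra.ι k w) = algebraMap k _ (d w) :=
    CliffordAlgebra.contractLeft_ι (Q := (0 : QuadraticForm k g)) d w
  rw [wedgeContract, LinearMap.comp_apply, h, LinearMap.mulLeft_apply, Algebra.smul_def,
    Algebra.commutes]

theorem wedgeContract_algebraMap (v : g) (d : Module.Dual k g) (r : k) :
    wedgeContract v d (algebraMap k _ r) = 0 := by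
  have h : CliffordAlgebra.contractLeft d (algebraMap k (ExteriorAlgebra k g) r) = 0 :=
    CliffordAlgebra.contractLeft_algebraMap (Q := (0 : QuadraticForm k g)) d r
  rw [wedgeContract, LinearMap.comp_apply, h, map_zero]

theorem wedgeContract_mul (v : g) (d : Module.Dual k g) (x y : ExteriorAlgebra k g) :
    wedgeContract v d (x * y) = wedgeContract v d x * y + x * wedgeContract v d y := by
  induction x using ExteriorAlgebra.induction generalizing y with
  | algebraMap r =>
    rw [wedgeContract_algebraMap, zero_mul, zero_add, ← Algebra.smul_def, ← Algebra.smul_def,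
      map_smul]
  | ι w =>
    have h : CliffordAlgebra.contractLeft d (ExteriorAlgebra.ι k w * y) =
        d w • y - ExteriorAlgebra.ι k w * CliffordAlgebra.contractLeft d y :=
      CliffordAlgebra.contractLeft_ι_mul (Q := (0 : QuadraticForm k g)) d w y
    have h2 : ExteriorAlgebra.ι k v * ExteriorAlgebra.ι k w =
        -(ExteriorAlgebra.ι k w * ExteriorAlgebra.ι k v) :=
      eq_neg_of_add_eq_zero_left (ExteriorAlgebra.ι_add_mul_swap v w)
    rw [wedgeContract_ι, wedgeContract, LinearMap.comp_apply, h, LinearMap.comp_apply,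
      LinearMap.mulLeft_apply, LinearMap.mulLeft_apply, mul_sub, mul_smul_comm, smul_mul_assoc,
      ← mul_assoc, ← mul_assoc, h2, neg_mul, sub_neg_eq_add]
  | mul a c ha hc =>
    rw [mul_assoc, ha, hc, ha, mul_add, add_mul]
    simp only [mul_assoc]
    abel
  | add a c ha hc => rw [add_mul, map_add, ha, hc, map_add, add_mul, add_mul]; abel

variable (b : Module.Basis (Fin n) k g)
  (φ : g →ₗ⁅k⁆ Derivation k (SHat k n) (SHat k n))

/-- The matrix over `Ŝ(g*)` with entries `φ^j_i = φ(-x̂_i)(∂^j)`; the upper index `j` is the row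
and the lower index `i` is the column. -/
def phiMatrix : Matrix (Fin n) (Fin n) (SHat k n) :=
  Matrix.of fun j i => φ (-b i) (MvPowerSeries.X j)

/-- `φ` is close to the identity, `φ^j_i = δ^j_i + O(∂)`: the matrix of constant terms of
the `φ^j_i` is the unit matrix. -/
def CloseToIdentity : Prop :=
  (phiMatrix b φ).map MvPowerSeries.constantCoeff = 1

/-- `∑_{s,r} (φ⁻¹)^p_s (∂φ^s_l/∂(∂^r)) φ(x)(∂^r)`, the coefficient of `dx̂_p` in `φ̃(x)(dx̂_l)`. -/
def connCoeff (x : g) (p l : Fin n) : SHat k n :=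
  ∑ s, ∑ r, (phiMatrix b φ)⁻¹ p s * MvPowerSeries.pderiv k r (phiMatrix b φ s l) *
    φ x (MvPowerSeries.X r)

/-- The operator `φ̃(x)` on `Λ(g) ⊗ Ŝ(g*)`. -/
def tildeOp (x : g) : Module.End k (FormSeries k g n) :=
  TensorProduct.map LinearMap.id (φ x).toLinearMap +
    ∑ p, ∑ l, TensorProduct.map (wedgeContract (b p) (b.coord l))
      (LinearMap.mulLeft k (connCoeff b φ x p l))

/-- `φ̃(x)` extends `φ(x)`. -/
theorem tildeOp_series (x : g) (P : SHat k n) :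
    tildeOp b φ x (1 ⊗ₜ P) = 1 ⊗ₜ φ x P := by
  have h : ∀ p l, wedgeContract (b p) (b.coord l) (1 : ExteriorAlgebra k g) = 0 := fun p l => by
    rw [← map_one (algebraMap k (ExteriorAlgebra k g)), wedgeContract_algebraMap]
  simp [tildeOp, LinearMap.sum_apply, h]

/-- `φ̃(x)(dx̂_l) = ∑_{p,s,r} dx̂_p (φ⁻¹)^p_s (∂φ^s_l/∂(∂^r)) φ(x)(∂^r)`. -/
theorem tildeOp_form (x : g) (l : Fin n) :
    tildeOp b φ x (ExteriorAlgebra.ι k (b l) ⊗ₜ 1) =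
      ∑ p, ExteriorAlgebra.ι k (b p) ⊗ₜ connCoeff b φ x p l := by
  classical
  simp [tildeOp, LinearMap.sum_apply, wedgeContract_ι, Finsupp.single_apply, ite_smul,
    TensorProduct.ite_tmul]

/-- `φ̃(x)` is a derivation. -/
theorem tildeOp_mul (x : g) (ω η : FormSeries k g n) :
    tildeOp b φ x (ω * η) = tildeOp b φ x ω * η + ω * tildeOp b φ x η := by
  induction ω using TensorProduct.induction_on with
  | zero => simp
  | add ω ω' h h' => simp only [add_mul, map_add, h, h']; abel
  | tmul u P =>
  induction η using TensorProduct.induction_on with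
  | zero => simp
  | add ω ω' h h' => simp only [mul_add, map_add, h, h']; abel
  | tmul v Q =>
    simp only [tildeOp, LinearMap.add_apply, LinearMap.sum_apply, TensorProduct.map_tmul,
      Algebra.TensorProduct.tmul_mul_tmul, LinearMap.id_apply, wedgeContract_mul,
      LinearMap.mulLeft_apply, add_mul, mul_add, Finset.sum_mul, Finset.mul_sum,
      TensorProduct.add_tmul, Finset.sum_add_distrib, Derivation.coeFn_coe, Derivation.leibniz,
      smul_eq_mul, TensorProduct.tmul_add, mul_assoc, mul_left_comm P, mul_comm (φ x P) Q]
    abel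

theorem derivation_ext {D D' : Module.End k (FormSeries k g n)}
    (hD : ∀ a c, D (a * c) = D a * c + a * D c) (hD' : ∀ a c, D' (a * c) = D' a * c + a * D' c)
    (hs : ∀ P, D (1 ⊗ₜ P) = D' (1 ⊗ₜ P))
    (hf : ∀ l, D (ExteriorAlgebra.ι k (b l) ⊗ₜ 1) = D' (ExteriorAlgebra.ι k (b l) ⊗ₜ 1)) :
    D = D' := by
  have hι : ∀ v : g, D (ExteriorAlgebra.ι k v ⊗ₜ 1) = D' (ExteriorAlgebra.ι k v ⊗ₜ 1) := by
    let F : g →ₗ[k] FormSeries k g n :=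
      (TensorProduct.mk k (ExteriorAlgebra k g) (SHat k n)).flip 1 ∘ₗ ExteriorAlgebra.ι k
    have : D ∘ₗ F = D' ∘ₗ F := b.ext hf
    exact fun v => LinearMap.congr_fun this v
  have hΛ : ∀ u : ExteriorAlgebra k g, D (u ⊗ₜ 1) = D' (u ⊗ₜ 1) := by
    intro u
    induction u using ExteriorAlgebra.induction with
    | algebraMap r =>
      have : (algebraMap k (ExteriorAlgebra k g) r ⊗ₜ 1 : FormSeries k g n) =
          1 ⊗ₜ (r • 1) := by
        rw [Algebra.algebraMap_eq_smul_one, TensorProduct.smul_tmul]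
      rw [this, hs]
    | ι v => exact hι v
    | mul a c ha hc =>
      have : ((a * c) ⊗ₜ 1 : FormSeries k g n) = (a ⊗ₜ 1) * (c ⊗ₜ 1) := by simp
      rw [this, hD, hD', ha, hc]
    | add a c ha hc => rw [TensorProduct.add_tmul, map_add, map_add, ha, hc]
  refine TensorProduct.ext' fun u P => ?_
  have : (u ⊗ₜ P : FormSeries k g n) = (u ⊗ₜ 1) * (1 ⊗ₜ P) := by simp
  rw [this, hD, hD', hΛ, hs]

variable {b φ}

theorem isUnit_det_phiMatrix (hφ : CloseToIdentity b φ) : IsUnit (phiMatrix b φ).det := by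
  rw [MvPowerSeries.isUnit_iff_constantCoeff, RingHom.map_det, RingHom.mapMatrix_apply, hφ,
    Matrix.det_one]
  exact isUnit_one

variable (b φ) in
theorem connCoeff_eq (x : g) :
    Matrix.of (connCoeff b φ x) = (phiMatrix b φ)⁻¹ * (phiMatrix b φ).map (φ x) := by
  ext1 p l
  simp only [Matrix.of_apply, connCoeff, Matrix.mul_apply, Matrix.map_apply]
  refine Finset.sum_congr rfl fun s _ => ?_
  rw [derivation_chain_rule (φ x), Finset.mul_sum]
  exact Finset.sum_congr rfl fun r _ => mul_assoc _ _ _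

theorem map_derivation_mul (D : Derivation k (SHat k n) (SHat k n))
    (M N : Matrix (Fin n) (Fin n) (SHat k n)) :
    (M * N).map D = M.map D * N + M * N.map D := by
  ext1 i j
  simp only [Matrix.map_apply, Matrix.mul_apply, Matrix.add_apply, map_sum, Derivation.leibniz,
    smul_eq_mul, ← Finset.sum_add_distrib]
  exact Finset.sum_congr rfl fun s _ => by ring

/-- The matrices of coefficients of `φ̃` satisfy the zero curvature equation. -/
theorem connCoeff_flat (hφ : CloseToIdentity b φ) (x y : g) :
    Matrix.of (connCoeff b φ ⁅x, y⁆) =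
      (Matrix.of (connCoeff b φ x) * Matrix.of (connCoeff b φ y) +
        (Matrix.of (connCoeff b φ y)).map (φ x)) -
      (Matrix.of (connCoeff b φ y) * Matrix.of (connCoeff b φ x) +
        (Matrix.of (connCoeff b φ x)).map (φ y)) := by
  have hu := isUnit_det_phiMatrix hφ
  set M := phiMatrix b φ with hM
  have hinv : ∀ z, M⁻¹.map (φ z) = -(M⁻¹ * M.map (φ z) * M⁻¹) := by
    intro z
    have h1 := map_derivation_mul (φ z) M⁻¹ M
    rw [Matrix.nonsing_inv_mul M hu] at h1
    have h0 : (1 : Matrix (Fin n) (Fin n) (SHat k n)).map (φ z) = 0 := by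
      ext1 i j
      rw [Matrix.map_apply, Matrix.one_apply]
      split_ifs <;> simp
    rw [h0] at h1
    have h2 : M⁻¹.map (φ z) * M = -(M⁻¹ * M.map (φ z)) := eq_neg_of_add_eq_zero_left h1.symm
    calc M⁻¹.map (φ z) = M⁻¹.map (φ z) * M * M⁻¹ := by
          rw [Matrix.mul_assoc, Matrix.mul_nonsing_inv M hu, Matrix.mul_one]
      _ = _ := by rw [h2, Matrix.neg_mul]
  have hcomm : M.map (φ ⁅x, y⁆) = (M.map (φ y)).map (φ x) - (M.map (φ x)).map (φ y) := by
    ext1 i j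
    simp only [Matrix.map_apply, Matrix.sub_apply, LieHom.map_lie, Derivation.commutator_apply]
  have key : ∀ x y, Matrix.of (connCoeff b φ x) * Matrix.of (connCoeff b φ y) +
        (Matrix.of (connCoeff b φ y)).map (φ x) = M⁻¹ * (M.map (φ y)).map (φ x) := by
    intro x y
    rw [connCoeff_eq, connCoeff_eq, ← hM, map_derivation_mul, hinv]
    simp only [Matrix.neg_mul, Matrix.mul_assoc]
    abel
  rw [key, key, connCoeff_eq, ← hM, hcomm, Matrix.mul_sub]

/-- The extension of `φ` to a Lie homomorphism `φ̃` from `g` to the derivations of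
`Λ(g) ⊗ Ŝ(g*)`. -/
def tilde (hφ : CloseToIdentity b φ) : g →ₗ⁅k⁆ Module.End k (FormSeries k g n) where
  toFun := tildeOp b φ
  map_add' x y := derivation_ext b (tildeOp_mul b φ _)
    (fun a c => by simp only [LinearMap.add_apply, tildeOp_mul, add_mul, mul_add]; abel)
    (fun P => by simp [tildeOp_series, TensorProduct.tmul_add])
    (fun l => by
      simp [tildeOp_form, connCoeff, mul_add, Finset.sum_add_distrib, TensorProduct.tmul_add])
  map_smul' r x := derivation_ext b (tildeOp_mul b φ _)
    (fun a c => by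
      simp only [RingHom.id_apply, LinearMap.smul_apply, tildeOp_mul, smul_add]
      rw [smul_mul_assoc, mul_smul_comm])
    (fun P => by simp [tildeOp_series])
    (fun l => by simp [tildeOp_form, connCoeff, Finset.smul_sum, ← TensorProduct.tmul_smul])
  map_lie' {x y} := derivation_ext b (tildeOp_mul b φ _)
    (fun a c => by
      simp only [LieRing.of_associative_ring_bracket, LinearMap.sub_apply, Module.End.mul_apply,
        tildeOp_mul, map_add, sub_mul, mul_sub]
      abel)
    (fun P => by
      simp [LieRing.of_associative_ring_bracket, tildeOp_series, Derivation.commutator_apply,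
        TensorProduct.tmul_sub])
    (fun l => by
      have h1 : ∀ x (p : Fin n) (Q : SHat k n),
          tildeOp b φ x (ExteriorAlgebra.ι k (b p) ⊗ₜ Q) =
            ∑ q, ExteriorAlgebra.ι k (b q) ⊗ₜ (connCoeff b φ x q p * Q) +
              ExteriorAlgebra.ι k (b p) ⊗ₜ φ x Q := by
        intro x p Q
        have : (ExteriorAlgebra.ι k (b p) ⊗ₜ Q : FormSeries k g n) =
          (ExteriorAlgebra.ι k (b p) ⊗ₜ 1) * (1 ⊗ₜ Q) := by simp
        rw [this, tildeOp_mul, tildeOp_form, tildeOp_series]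
        simp [Finset.sum_mul]
      have h2 : ∀ x y, tildeOp b φ x (tildeOp b φ y (ExteriorAlgebra.ι k (b l) ⊗ₜ 1)) =
          ∑ q, ExteriorAlgebra.ι k (b q) ⊗ₜ
            ((Matrix.of (connCoeff b φ x) * Matrix.of (connCoeff b φ y) +
              (Matrix.of (connCoeff b φ y)).map (φ x)) q l) := by
        intro x y
        rw [tildeOp_form]
        simp only [map_sum, h1, Finset.sum_add_distrib, Matrix.add_apply,
          Matrix.mul_apply, Matrix.map_apply, Matrix.of_apply, TensorProduct.tmul_add,
          TensorProduct.tmul_sum]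
        rw [Finset.sum_comm]
      rw [LieRing.of_associative_ring_bracket, LinearMap.sub_apply, Module.End.mul_apply,
        Module.End.mul_apply, h2, h2, tildeOp_form, ← Finset.sum_sub_distrib]
      refine Finset.sum_congr rfl fun q _ => ?_
      rw [← TensorProduct.tmul_sub, ← Matrix.sub_apply, ← connCoeff_flat hφ, Matrix.of_apply])

/-- The right Hopf action `γ ∘ φ̃` of `U(g)` on `Λ(g) ⊗ Ŝ(g*)`. -/
def twistedAction (hφ : CloseToIdentity b φ) :
    RightHopfAction k (UniversalEnvelopingAlgebra k g) (FormSeries k g n) :=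
  rightActionU (tilde hφ) (tildeOp_mul b φ)

/-- The extended algebra `U(g) ♯ (Λ(g) ⊗ Ŝ(g*))` of `φ`-twisted differential forms. -/
abbrev TwistedAlg (hφ : CloseToIdentity b φ) : Type _ := Smash (twistedAction hφ)

/-- The generator `x̂_i` of the algebra of twisted forms. -/
def TwistedAlg.x (hφ : CloseToIdentity b φ) (i : Fin n) : TwistedAlg hφ :=
  Smash.inl (twistedAction hφ) (UniversalEnvelopingAlgebra.ι k (b i))

/-- The generator `∂^i` of the algebra of twisted forms. -/
def TwistedAlg.del (hφ : CloseToIdentity b φ) (i : Fin n) : TwistedAlg hφ :=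
  Smash.inr (twistedAction hφ) (1 ⊗ₜ MvPowerSeries.X i)

/-- The generator `dx̂_i` of the algebra of twisted forms. -/
def TwistedAlg.dx (hφ : CloseToIdentity b φ) (i : Fin n) : TwistedAlg hφ :=
  Smash.inr (twistedAction hφ) (ExteriorAlgebra.ι k (b i) ⊗ₜ 1)

end Forms

end TwistedForms

end

open TwistedForms

/-! The formula for `φ̃` is a pure gauge connection. By the chain rule for derivations of Ŝ(g*), the
matrix by which φ̃(x) moves the dx̂_l is φ⁻¹ · φ(x)(φ). Hence the automorphism θ of Λ(g) ⊗ Ŝ(g*)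
over Ŝ(g*) with dx_l ↦ ∑_j dx_j φ^j_l carries φ̃(x) to id ⊗ φ(x) (`phiFrame_tildeOp`). In Â_n the
element ∑_j x_j D(∂^j) has commutator D(P) with a series P, and x̂_i ↦ ∑_j x_j φ^j_i is a Lie
homomorphism. So θ on forms and this realization on U(g) satisfy the commutation relation of the
smash product and glue to `toWeylForms`.

The inverse should send x_a to X_a = ∑_i x̂_i (φ⁻¹)^i_a and a form ω to θ⁻¹(ω). Its relations hold
after applying `toWeylForms`, so it suffices to confine each defect to a subspace on which that map
is visibly injective. The commutator [X_a, X_c] lies in ∑_i x̂_i Ŝ(g*)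
(`TwistedAlg.commutator_mem`), where injectivity follows from the part linear in the x_j and the
invertibility of φ. The commutator of a form with X_a is a form
(`TwistedAlg.exists_inr_commutator_flatX`), and on forms the map is θ followed by an inclusion. This
makes the inverse well defined without the Poincaré–Birkhoff–Witt theorem; both composites are
checked on U(g) or S(g) generators and on forms or series.

Uniqueness is not formal: the ∂^i do not generate Ŝ(g*) as an algebra, and no continuity is assumed.
If f is a homomorphism fixing the ∂^i and P = c + ∑_i ∂^i q_i, then f(P) - P = ∑_i (f(q_i) - q_i)
∂^i. Iteration makes f(P) - P divisible on the right by arbitrarily high powers of the ideal of the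
∂^i, and the target is separated for these powers (`algHom_series_eq`). -/

namespace TwistedForms

/-! ### Universal property of smash products with primitive generators -/

section Smash

variable {k H A B : Type*} [CommRing k] [Ring H] [Bialgebra k H] [Ring A] [Algebra k A]
  [Ring B] [Algebra k B] (α : RightHopfAction k H A)

namespace Smash

theorem inl_mul_inr (u : H) (a : A) : inl α u * inr α a = tmul α u a := by
  change mulMap α (u ⊗ₜ 1) (1 ⊗ₜ a) = u ⊗ₜ a
  simp [mulMap_tmul, Algebra.TensorProduct.one_def, α.act_one]

theorem induction_inl_mul_inr {p : Smash α → Prop} (x : Smash α) (zero : p 0)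
    (mul : ∀ u a, p (inl α u * inr α a)) (add : ∀ x y, p x → p y → p (x + y)) : p x :=
  TensorProduct.induction_on (motive := p) x zero
    (fun u a => by have := mul u a; rwa [inl_mul_inr] at this) add

theorem inr_injective : Function.Injective (inr α) := by
  let L : Smash α →ₗ[k] A := (TensorProduct.lid k A).toLinearMap ∘ₗ
    TensorProduct.map Coalgebra.counit LinearMap.id
  refine Function.LeftInverse.injective (g := L) fun a => ?_
  change TensorProduct.lid k A (TensorProduct.map Coalgebra.counit LinearMap.id
    ((1 : H) ⊗ₜ[k] a)) = a
  simp

theorem tmul_mul_inr (u : H) (a c : A) :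
    tmul α u a * inr α c = tmul α u (a * c) := by
  rw [← inl_mul_inr, mul_assoc, ← map_mul, inl_mul_inr]

/-- Primitive elements of `H` satisfy `a x = x a + (a ◁ x)` in `H ♯ A`. -/
theorem inr_mul_inl_of_primitive {x : H}
    (hx : Coalgebra.comul (R := k) x = x ⊗ₜ 1 + 1 ⊗ₜ x) (a : A) :
    inr α a * inl α x = inl α x * inr α a + inr α (α.act a x) := by
  rw [inl_mul_inr]
  change mulMap α (1 ⊗ₜ a) (x ⊗ₜ 1) = x ⊗ₜ a + 1 ⊗ₜ α.act a x
  simp [mulMap_tmul, hx, α.act_one]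
  rfl

theorem algHom_ext {F F' : Smash α →ₐ[k] B} (hl : F.comp (inl α) = F'.comp (inl α))
    (hr : F.comp (inr α) = F'.comp (inr α)) : F = F' := by
  ext x
  induction x using induction_inl_mul_inr with
  | zero => simp
  | mul u a =>
    rw [map_mul, map_mul]
    exact congrArg₂ _ (DFunLike.congr_fun hl u) (DFunLike.congr_fun hr a)
  | add x y hx hy => rw [map_add, map_add, hx, hy]

variable (f : H →ₐ[k] B) (h : A →ₐ[k] B) {G : Set H}

/-- If the commutation relation of the smash product holds for a set of primitive generators, then
it holds for all elements. -/
theorem commutation_of_primitive (hG : Algebra.adjoin k G = ⊤)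
    (hΔ : ∀ x ∈ G, Coalgebra.comul (R := k) x = x ⊗ₜ 1 + 1 ⊗ₜ x)
    (hc : ∀ x ∈ G, ∀ a, h a * f x = f x * h a + h (α.act a x)) (v : H) (a : A) :
    LinearMap.mul' k B (TensorProduct.map f.toLinearMap (h.toLinearMap ∘ₗ α.act a)
      (Coalgebra.comul (R := k) v)) = h a * f v := by
  have hv : v ∈ Algebra.adjoin k G := hG ▸ Algebra.mem_top
  -- The element `a` must vary: for a product `x * y`, moving `h a` past `f x` leaves `h (a ◁ x₂)`,
  -- which then has to move past `f y`.
  induction hv using Algebra.adjoin_induction generalizing a with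
  | mem x hx => simp [hΔ x hx, hc x hx, α.act_one]
  | algebraMap r =>
    simp [Algebra.algebraMap_eq_smul_one, Algebra.TensorProduct.one_def, α.act_one]
  | add x y _ _ hx hy => simp only [map_add, hx, hy, mul_add]
  | mul x y _ _ hx hy =>
    rw [Bialgebra.comul_mul, map_mul f, ← mul_assoc, ← hx]
    generalize Coalgebra.comul (R := k) x = t
    induction t with
    | zero => simp
    | add t t' ht ht' => simp only [add_mul, map_add, ht, ht']
    | tmul p q =>
      simp only [TensorProduct.map_tmul, LinearMap.mul'_apply, LinearMap.comp_apply,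
        AlgHom.toLinearMap_apply]
      rw [mul_assoc, ← hy]
      generalize Coalgebra.comul (R := k) y = s
      induction s with
      | zero => simp
      | add s s' hs hs' => simp only [mul_add, map_add, hs, hs']
      | tmul p' q' => simp [α.act_mul, mul_assoc]

/-- The universal property of the smash product of a bialgebra generated by primitive elements. -/
noncomputable def liftPrimitive (hG : Algebra.adjoin k G = ⊤)
    (hΔ : ∀ x ∈ G, Coalgebra.comul (R := k) x = x ⊗ₜ 1 + 1 ⊗ₜ x)
    (hc : ∀ x ∈ G, ∀ a, h a * f x = f x * h a + h (α.act a x)) : Smash α →ₐ[k] B :=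
  AlgHom.ofLinearMap (LinearMap.mul' k B ∘ₗ TensorProduct.map f.toLinearMap h.toLinearMap)
    (by
      change LinearMap.mul' k B (TensorProduct.map _ _ (1 ⊗ₜ 1)) = 1
      simp)
    (by
      intro x y
      induction x using induction_inl_mul_inr with
      | zero => simp
      | add x x' hx hx' => simp only [add_mul, map_add, hx, hx']
      | mul u a =>
      induction y using induction_inl_mul_inr with
      | zero => simp
      | add x x' hx hx' => simp only [mul_add, map_add, hx, hx']
      | mul v c =>
        rw [inl_mul_inr, inl_mul_inr]
        change LinearMap.mul' k B (TensorProduct.map f.toLinearMap h.toLinearMap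
          (mulMap α (u ⊗ₜ a) (v ⊗ₜ c))) =
            LinearMap.mul' k B (TensorProduct.map f.toLinearMap h.toLinearMap (u ⊗ₜ a)) *
            LinearMap.mul' k B (TensorProduct.map f.toLinearMap h.toLinearMap (v ⊗ₜ c))
        -- The product of the images is `f u * h a * f v * h c`; only the two middle factors have to
        -- be reordered.
        have key := commutation_of_primitive α f h hG hΔ hc v a
        simp only [TensorProduct.map_tmul, LinearMap.mul'_apply, AlgHom.toLinearMap_apply]
        rw [mul_assoc, ← mul_assoc (h a), ← key, mulMap_tmul]
        generalize Coalgebra.comul (R := k) v = t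
        induction t with
        | zero => simp
        | add t t' ht ht' => simp only [add_mul, mul_add, map_add, ht, ht']
        | tmul p q => simp [mul_assoc])

theorem liftPrimitive_inl (hG : Algebra.adjoin k G = ⊤)
    (hΔ : ∀ x ∈ G, Coalgebra.comul (R := k) x = x ⊗ₜ 1 + 1 ⊗ₜ x)
    (hc : ∀ x ∈ G, ∀ a, h a * f x = f x * h a + h (α.act a x)) (u : H) :
    liftPrimitive α f h hG hΔ hc (inl α u) = f u := by
  change LinearMap.mul' k B (TensorProduct.map f.toLinearMap h.toLinearMap (u ⊗ₜ 1)) = f u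
  simp

theorem liftPrimitive_inr (hG : Algebra.adjoin k G = ⊤)
    (hΔ : ∀ x ∈ G, Coalgebra.comul (R := k) x = x ⊗ₜ 1 + 1 ⊗ₜ x)
    (hc : ∀ x ∈ G, ∀ a, h a * f x = f x * h a + h (α.act a x)) (a : A) :
    liftPrimitive α f h hG hΔ hc (inr α a) = h a := by
  change LinearMap.mul' k B (TensorProduct.map f.toLinearMap h.toLinearMap (1 ⊗ₜ a)) = h a
  simp

end Smash

end Smash

/-! ### The semicompleted Weyl algebra and separatedness over the power series -/

section Weyl

variable {k g : Type*} [Field k] [AddCommGroup g] [Module k g] {n : ℕ}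
  (b : Module.Basis (Fin n) k g)

theorem WeylHat.x_mul_x (i j : Fin n) :
    WeylHat.x b i * WeylHat.x b j = WeylHat.x b j * WeylHat.x b i := by
  rw [WeylHat.x, WeylHat.x, ← map_mul, mul_comm, map_mul]

theorem weylAction_act_ι (P : SHat k n) (x : g) :
    (weylAction b).act P (SymmetricAlgebra.ι k g x) =
      ∑ j, b.repr x j • MvPowerSeries.pderiv k j P := by
  rw [RightHopfAction.act_apply]
  change (liftSym (dirDeriv b) (dirDeriv_comm b) (SymmetricAlgebra.ι k g x)).unop P = _
  rw [liftSym_ι, dirDeriv_apply]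

/-- `[P, x_j] = ∂P/∂(∂^j)` in the semicompleted Weyl algebra. -/
theorem WeylHat.ofSeries_mul_x (P : SHat k n) (j : Fin n) :
    WeylHat.ofSeries b P * WeylHat.x b j =
      WeylHat.x b j * WeylHat.ofSeries b P +
        WeylHat.ofSeries b (MvPowerSeries.pderiv k j P) := by
  classical
  rw [WeylHat.ofSeries, WeylHat.x,
    Smash.inr_mul_inl_of_primitive _ (SymmetricAlgebra.comul_ι k g (b j)), weylAction_act_ι]
  simp [Finsupp.single_apply, ite_smul]

/-- Agreement is required on all series and not just on the `∂^i`, which generate only the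
polynomials. -/
theorem WeylHat.algHom_ext {B : Type*} [Ring B] [Algebra k B] {F F' : WeylHat b →ₐ[k] B}
    (hx : ∀ j, F (WeylHat.x b j) = F' (WeylHat.x b j))
    (hs : ∀ P, F (WeylHat.ofSeries b P) = F' (WeylHat.ofSeries b P)) : F = F' := by
  refine Smash.algHom_ext _ ?_ (AlgHom.ext hs)
  refine AlgHom.ext_of_adjoin_eq_top adjoin_range_ιSym ?_
  rintro _ ⟨x, rfl⟩
  exact LinearMap.congr_fun (b.ext (f₁ := (F.comp (Smash.inl _)).toLinearMap ∘ₗ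
    SymmetricAlgebra.ι k g) (f₂ := (F'.comp (Smash.inl _)).toLinearMap ∘ₗ
    SymmetricAlgebra.ι k g) hx) x

/-- The centralizer of `z` is a subalgebra. This serves to make the images of Λ(g) and Â_n commute
in the algebra of twisted forms. -/
theorem WeylHat.commute_of_generators {B : Type*} [Ring B] [Algebra k B] (F : WeylHat b →ₐ[k] B)
    {z : B} (hx : ∀ j, Commute z (F (WeylHat.x b j)))
    (hs : ∀ P, Commute z (F (WeylHat.ofSeries b P))) (w : WeylHat b) : Commute z (F w) := by
  have hl : ∀ p : SymmetricAlgebra k g, Commute z (F (Smash.inl _ p)) := by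
    intro p
    induction p using SymmetricAlgebra.induction with
    | algebraMap r =>
      rw [AlgHom.commutes, AlgHom.commutes]
      exact (Algebra.commutes r z).symm
    | ι x =>
      rw [← b.sum_repr x, map_sum, map_sum, map_sum]
      refine Commute.sum_right _ _ _ fun j _ => ?_
      rw [map_smul, map_smul, map_smul]
      exact (hx j).smul_right _
    | mul p q hp hq => rw [map_mul, map_mul]; exact hp.mul_right hq
    | add p q hp hq => rw [map_add, map_add]; exact hp.add_right hq
  induction w using Smash.induction_inl_mul_inr with
  | zero => rw [map_zero]; exact Commute.zero_right z
  | mul p P => rw [map_mul]; exact (hl p).mul_right (hs P)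
  | add w w' h h' => rw [map_add]; exact h.add_right h'

/-- `∑_j x_j P_j` determines the power series `P_j`. -/
theorem WeylHat.eq_zero_of_sum_x_mul_ofSeries {P : Fin n → SHat k n}
    (h : ∑ j, WeylHat.x b j * WeylHat.ofSeries b (P j) = 0) : P = 0 := by
  funext i
  -- The coefficient of the monomial `x_i`; applied to the left tensor factor it isolates `P i`.
  let d : SymmetricAlgebra k g →ₗ[k] k :=
    MvPolynomial.lcoeff k (Finsupp.single i 1) ∘ₗ
      (SymmetricAlgebra.equivMvPolynomial b).toLinearMap
  have hd : ∀ j, d (SymmetricAlgebra.ι k g (b j)) = if j = i then 1 else 0 := fun j => by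
    simp [d, MvPolynomial.coeff_X, Finsupp.single_left_inj]
  let L : WeylHat b →ₗ[k] SHat k n :=
    (TensorProduct.lid k (SHat k n)).toLinearMap ∘ₗ TensorProduct.map d LinearMap.id
  have hL : ∀ j, L (WeylHat.x b j * WeylHat.ofSeries b (P j)) = if j = i then P j else 0 := by
    intro j
    rw [WeylHat.x, WeylHat.ofSeries, Smash.inl_mul_inr]
    change TensorProduct.lid k _ (TensorProduct.map d LinearMap.id (_ ⊗ₜ[k] P j)) = _
    simp [hd]
  have := congrArg L h
  simpa [map_sum, hL] using this

/-- The component in `Ŝ(g*)` of an element of `Λ(g) ⊗ S(g) ⊗ Ŝ(g*)`, with respect to a linear form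
on `Λ(g) ⊗ S(g)`. -/
noncomputable def seriesComponent (d : ExteriorAlgebra k g ⊗[k] SymmetricAlgebra k g →ₗ[k] k) :
    ExteriorAlgebra k g ⊗[k] WeylHat b →ₗ[k] SHat k n :=
  ((TensorProduct.lid k (SHat k n)).toLinearMap ∘ₗ TensorProduct.map d LinearMap.id) ∘ₗ
    (TensorProduct.assoc k (ExteriorAlgebra k g) (SymmetricAlgebra k g) (SHat k n)).symm.toLinearMap

theorem seriesComponent_tmul (d : ExteriorAlgebra k g ⊗[k] SymmetricAlgebra k g →ₗ[k] k)
    (u : ExteriorAlgebra k g) (p : SymmetricAlgebra k g) (P : SHat k n) :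
    seriesComponent b d (u ⊗ₜ Smash.tmul (weylAction b) p P) = d (u ⊗ₜ p) • P := by
  change TensorProduct.lid k (SHat k n) (TensorProduct.map d LinearMap.id
    ((TensorProduct.assoc k _ _ _).symm (u ⊗ₜ[k] (p ⊗ₜ[k] P)))) = _
  simp

/-- In Â_n the series stand to the right of the `x_j`, so right multiplication by a series affects
the last tensor factor only. Components are thus linear over Ŝ(g*) acting on the right. -/
theorem seriesComponent_mul_ofSeries
    (d : ExteriorAlgebra k g ⊗[k] SymmetricAlgebra k g →ₗ[k] k)
    (ω : ExteriorAlgebra k g ⊗[k] WeylHat b) (P : SHat k n) :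
    seriesComponent b d (ω * (1 ⊗ₜ WeylHat.ofSeries b P)) = seriesComponent b d ω * P := by
  induction ω using TensorProduct.induction_on with
  | zero => simp
  | add ω ω' h h' => simp only [add_mul, map_add, h, h']
  | tmul u w =>
    induction w using Smash.induction_inl_mul_inr with
    | zero => simp
    | add w w' h h' => simp only [TensorProduct.tmul_add, add_mul, map_add, h, h']
    | mul p Q =>
      rw [Algebra.TensorProduct.tmul_mul_tmul, mul_one, Smash.inl_mul_inr, WeylHat.ofSeries,
        Smash.tmul_mul_inr, seriesComponent_tmul, seriesComponent_tmul, smul_mul_assoc]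

/-- The coordinate forms of a vector space basis of Λ(g) ⊗ S(g) already detect every tensor. This
reduces separatedness of the target to that of Ŝ(g*). -/
theorem eq_zero_of_seriesComponent_eq_zero {ω : ExteriorAlgebra k g ⊗[k] WeylHat b}
    (h : ∀ d, seriesComponent b d ω = 0) : ω = 0 := by
  classical
  let e := TensorProduct.assoc k (ExteriorAlgebra k g) (SymmetricAlgebra k g) (SHat k n)
  let c := Module.Basis.ofVectorSpace k (ExteriorAlgebra k g ⊗[k] SymmetricAlgebra k g)
  have hc : ∀ (i) (t : (ExteriorAlgebra k g ⊗[k] SymmetricAlgebra k g) ⊗[k] SHat k n),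
      TensorProduct.equivFinsuppOfBasisLeft c t i =
        TensorProduct.lid k _ (TensorProduct.map (c.coord i) LinearMap.id t) := by
    intro i t
    induction t using TensorProduct.induction_on with
    | zero => simp
    | add t t' h h' => simp [h, h']
    | tmul x P => simp
  refine (e.symm.map_eq_zero_iff).1 ?_
  refine ((TensorProduct.equivFinsuppOfBasisLeft c).map_eq_zero_iff).1 (Finsupp.ext fun i => ?_)
  rw [hc]
  exact h (c.coord i)

/-- A homomorphism from the power series to `Λ(g) ⊗ Â_n` is determined by its values at the
variables, if these are the `∂^i`. -/
theorem algHom_series_eq (f : SHat k n →ₐ[k] ExteriorAlgebra k g ⊗[k] WeylHat b)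
    (hf : ∀ i, f (MvPowerSeries.X i) = 1 ⊗ₜ WeylHat.del b i) (P : SHat k n) :
    f P = 1 ⊗ₜ WeylHat.ofSeries b P := by
  rw [← sub_eq_zero]
  refine eq_zero_of_seriesComponent_eq_zero b fun d => ?_
  -- The claim is made for all `P` at once, because the induction step replaces `P` by the quotients
  -- `q i`, at the gain of one factor `∂^i`.
  have h : ∀ (N : ℕ) (P : SHat k n) (m : Fin n →₀ ℕ), m.degree < N →
      MvPowerSeries.coeff m (seriesComponent b d (f P - 1 ⊗ₜ WeylHat.ofSeries b P)) = 0 := by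
    intro N
    induction N with
    | zero => intro P m h; exact absurd h (Nat.not_lt_zero _)
    | succ N ih =>
      intro P m hm
      obtain ⟨q, hq⟩ := exists_eq_C_add_sum P
      have key : f P - 1 ⊗ₜ WeylHat.ofSeries b P =
          ∑ i, (f (q i) - 1 ⊗ₜ WeylHat.ofSeries b (q i)) *
            (1 ⊗ₜ WeylHat.ofSeries b (MvPowerSeries.X i)) := by
        have hC : ∀ r : k, f (MvPowerSeries.C r) = 1 ⊗ₜ WeylHat.ofSeries b (MvPowerSeries.C r) := by
          intro r
          have : (MvPowerSeries.C r : SHat k n) = algebraMap k _ r := rfl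
          rw [this, AlgHom.commutes, AlgHom.commutes,
            Algebra.TensorProduct.algebraMap_apply']
        conv_lhs => rw [hq]
        rw [map_add, map_add, TensorProduct.tmul_add, hC, add_sub_add_left_eq_sub, map_sum, map_sum,
          TensorProduct.tmul_sum, ← Finset.sum_sub_distrib]
        refine Finset.sum_congr rfl fun i _ => ?_
        -- The variable is moved to the right of `q i` before `f` is applied, since components are
        -- linear only for right multiplication.
        rw [mul_comm, map_mul, map_mul, hf, sub_mul, Algebra.TensorProduct.tmul_mul_tmul, one_mul]
        rfl
      rw [key, map_sum, map_sum]
      refine Finset.sum_eq_zero fun i _ => ?_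
      rw [seriesComponent_mul_ofSeries, mul_comm, MvPowerSeries.X,
        MvPowerSeries.coeff_monomial_mul]
      split_ifs with hi
      · rw [ih, mul_zero]
        have h1 : (m - Finsupp.single i 1 + Finsupp.single i 1).degree = m.degree := by
          rw [tsub_add_cancel_of_le hi]
        rw [map_add, Finsupp.degree_single] at h1
        omega
      · rfl
  ext m
  rw [h (m.degree + 1) P m (Nat.lt_succ_self _), map_zero]

end Weyl

/-! ### Change of frame on forms and the gauge transformation of φ̃ -/

section Frame

variable {k g : Type*} [Field k] [LieRing g] [LieAlgebra k g] {n : ℕ}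
  (b : Module.Basis (Fin n) k g)

/-- The linear map `g → Λ(g) ⊗ Ŝ(g*)` sending `x_l` to `∑_j dx_j M^j_l`. -/
noncomputable def frameLin (M : Matrix (Fin n) (Fin n) (SHat k n)) : g →ₗ[k] FormSeries k g n :=
  b.constr k fun l => ∑ j, ExteriorAlgebra.ι k (b j) ⊗ₜ[k] M j l

theorem frameLin_basis (M : Matrix (Fin n) (Fin n) (SHat k n)) (l : Fin n) :
    frameLin b M (b l) = ∑ j, ExteriorAlgebra.ι k (b j) ⊗ₜ[k] M j l := by
  simp [frameLin]

/-- The `dx_j` anticommute and the coefficients commute, so exchanging the two summation indices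
gives w² = -w²; characteristic zero permits division by 2. -/
theorem sum_ι_tmul_mul_self [CharZero k] (P : Fin n → SHat k n) :
    (∑ j, ExteriorAlgebra.ι k (b j) ⊗ₜ[k] P j) * ∑ j, ExteriorAlgebra.ι k (b j) ⊗ₜ[k] P j =
      (0 : FormSeries k g n) := by
  set w : FormSeries k g n := ∑ j, ExteriorAlgebra.ι k (b j) ⊗ₜ[k] P j with hw
  have h : w * w = -(w * w) := by
    calc w * w = ∑ i, ∑ j, (ExteriorAlgebra.ι k (b i) * ExteriorAlgebra.ι k (b j)) ⊗ₜ[k]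
          (P i * P j) := by
          simp only [hw, Finset.sum_mul, Finset.mul_sum, Algebra.TensorProduct.tmul_mul_tmul]
          rw [Finset.sum_comm]
      _ = -∑ i, ∑ j, (ExteriorAlgebra.ι k (b j) * ExteriorAlgebra.ι k (b i)) ⊗ₜ[k]
          (P j * P i) := by
          simp only [← Finset.sum_neg_distrib, ← TensorProduct.neg_tmul]
          refine Finset.sum_congr rfl fun i _ => Finset.sum_congr rfl fun j _ => ?_
          rw [eq_neg_of_add_eq_zero_left (ExteriorAlgebra.ι_add_mul_swap (b i) (b j)),
            mul_comm (P i)]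
      _ = -(w * w) := by
          simp only [hw, Finset.sum_mul, Finset.mul_sum, Algebra.TensorProduct.tmul_mul_tmul]
  have h2 : (2 : k) • (w * w) = 0 := by
    rw [two_smul]
    nth_rewrite 2 [h]
    exact add_neg_cancel _
  exact (smul_eq_zero.1 h2).resolve_left two_ne_zero

theorem frameLin_mul_self [CharZero k] (M : Matrix (Fin n) (Fin n) (SHat k n)) (v : g) :
    frameLin b M v * frameLin b M v = 0 := by
  have : frameLin b M v =
      ∑ j, ExteriorAlgebra.ι k (b j) ⊗ₜ[k] ∑ l, b.repr v l • M j l := by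
    rw [frameLin, Module.Basis.constr_apply_fintype]
    simp only [TensorProduct.tmul_sum, TensorProduct.tmul_smul, Finset.smul_sum,
      Module.Basis.equivFun_apply]
    rw [Finset.sum_comm]
  rw [this, sum_ι_tmul_mul_self]

theorem commute_one_tmul (ω : FormSeries k g n) (P : SHat k n) :
    Commute ω (1 ⊗ₜ[k] P) := by
  induction ω using TensorProduct.induction_on with
  | zero => exact Commute.zero_left _
  | add x y hx hy => exact hx.add_left hy
  | tmul u Q => simp [Commute, SemiconjBy, mul_comm]

/-- The endomorphism of `Λ(g) ⊗ Ŝ(g*)` over `Ŝ(g*)` sending `dx_l` to `∑_j dx_j M^j_l`. -/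
noncomputable def frameHom [CharZero k] (M : Matrix (Fin n) (Fin n) (SHat k n)) :
    FormSeries k g n →ₐ[k] FormSeries k g n :=
  Algebra.TensorProduct.lift (ExteriorAlgebra.lift k ⟨frameLin b M, frameLin_mul_self b M⟩)
    Algebra.TensorProduct.includeRight fun _ P => commute_one_tmul _ P

theorem frameHom_series [CharZero k] (M : Matrix (Fin n) (Fin n) (SHat k n)) (P : SHat k n) :
    frameHom b M (1 ⊗ₜ P) = 1 ⊗ₜ P := by
  refine (Algebra.TensorProduct.lift_tmul _ _ _ _ _).trans ?_
  rw [map_one, one_mul]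
  rfl

theorem frameHom_form [CharZero k] (M : Matrix (Fin n) (Fin n) (SHat k n)) (l : Fin n) :
    frameHom b M (ExteriorAlgebra.ι k (b l) ⊗ₜ 1) = ∑ j, ExteriorAlgebra.ι k (b j) ⊗ₜ M j l := by
  refine (Algebra.TensorProduct.lift_tmul _ _ _ _ _).trans ?_
  rw [map_one, mul_one, ExteriorAlgebra.lift_ι_apply, frameLin_basis]

theorem formSeries_algHom_ext {B : Type*} [Ring B] [Algebra k B]
    {F F' : FormSeries k g n →ₐ[k] B} (hs : ∀ P, F (1 ⊗ₜ P) = F' (1 ⊗ₜ P))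
    (hf : ∀ l, F (ExteriorAlgebra.ι k (b l) ⊗ₜ 1) = F' (ExteriorAlgebra.ι k (b l) ⊗ₜ 1)) :
    F = F' := by
  refine Algebra.TensorProduct.ext (ExteriorAlgebra.hom_ext (b.ext hf)) (AlgHom.ext hs)

/-- Both maps fix the coefficients, so on the frame they compose by the matrix product `M * N`. -/
theorem frameHom_comp [CharZero k] {M N : Matrix (Fin n) (Fin n) (SHat k n)} (h : M * N = 1) :
    (frameHom b M).comp (frameHom b N) = AlgHom.id k (FormSeries k g n) := by
  classical
  refine formSeries_algHom_ext b (fun P => by simp [frameHom_series]) fun l => ?_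
  have h1 : ∀ (p : Fin n) (Q : SHat k n), frameHom b M (ExteriorAlgebra.ι k (b p) ⊗ₜ Q) =
      ∑ j, ExteriorAlgebra.ι k (b j) ⊗ₜ (M j p * Q) := by
    intro p Q
    have : (ExteriorAlgebra.ι k (b p) ⊗ₜ Q : FormSeries k g n) =
      (ExteriorAlgebra.ι k (b p) ⊗ₜ 1) * (1 ⊗ₜ Q) := by simp
    rw [this, map_mul, frameHom_form, frameHom_series]
    simp [Finset.sum_mul]
  rw [AlgHom.comp_apply, frameHom_form, map_sum]
  simp only [h1]
  rw [Finset.sum_comm]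
  simp only [← TensorProduct.tmul_sum, ← Matrix.mul_apply, h, Matrix.one_apply]
  simp [TensorProduct.tmul_ite]

variable {b} {φ : g →ₗ⁅k⁆ Derivation k (SHat k n) (SHat k n)}

/-- The automorphism of `Λ(g) ⊗ Ŝ(g*)` over `Ŝ(g*)` sending `dx_l` to `∑_j dx_j φ^j_l`. -/
noncomputable def phiFrame [CharZero k] (hφ : CloseToIdentity b φ) :
    FormSeries k g n ≃ₐ[k] FormSeries k g n :=
  AlgEquiv.ofAlgHom (frameHom b (phiMatrix b φ)) (frameHom b (phiMatrix b φ)⁻¹)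
    (frameHom_comp b (Matrix.mul_nonsing_inv _ (isUnit_det_phiMatrix hφ)))
    (frameHom_comp b (Matrix.nonsing_inv_mul _ (isUnit_det_phiMatrix hφ)))

theorem phiFrame_series [CharZero k] (hφ : CloseToIdentity b φ) (P : SHat k n) :
    phiFrame hφ (1 ⊗ₜ P) = 1 ⊗ₜ P := frameHom_series b _ P

theorem phiFrame_form [CharZero k] (hφ : CloseToIdentity b φ) (l : Fin n) :
    phiFrame hφ (ExteriorAlgebra.ι k (b l) ⊗ₜ 1) =
      ∑ j, ExteriorAlgebra.ι k (b j) ⊗ₜ phiMatrix b φ j l := frameHom_form b _ l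

theorem map_id_derivation_mul (D : Derivation k (SHat k n) (SHat k n)) (ω η : FormSeries k g n) :
    TensorProduct.map LinearMap.id D.toLinearMap (ω * η) =
      TensorProduct.map LinearMap.id D.toLinearMap ω * η +
        ω * TensorProduct.map LinearMap.id D.toLinearMap η := by
  induction ω using TensorProduct.induction_on with
  | zero => simp
  | add ω ω' h h' => simp only [add_mul, map_add, h, h']; abel
  | tmul u P =>
  induction η using TensorProduct.induction_on with
  | zero => simp
  | add ω ω' h h' => simp only [mul_add, map_add, h, h']; abel
  | tmul v Q =>
    simp only [TensorProduct.map_tmul, Algebra.TensorProduct.tmul_mul_tmul, LinearMap.id_apply,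
      Derivation.coeFn_coe, Derivation.leibniz, smul_eq_mul, TensorProduct.tmul_add,
      mul_comm (D P) Q]
    abel

/-- In the frame `∑_j dx_j φ^j_l`, the derivation `φ̃(x)` is `φ(x)` acting on coefficients. -/
theorem phiFrame_tildeOp [CharZero k] (hφ : CloseToIdentity b φ) (x : g) (ω : FormSeries k g n) :
    phiFrame hφ (tildeOp b φ x ω) =
      TensorProduct.map LinearMap.id (φ x).toLinearMap (phiFrame hφ ω) := by
  -- Conjugating id ⊗ φ(x) by the change of frame gives a derivation again, so the comparison with
  -- φ̃(x) need only be made on series and on the `dx̂_l`.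
  have h := derivation_ext b (D := tildeOp b φ x)
    (D' := (phiFrame hφ).symm.toLinearMap ∘ₗ TensorProduct.map LinearMap.id (φ x).toLinearMap ∘ₗ
      (phiFrame hφ).toLinearMap) (tildeOp_mul b φ x)
    (fun a c => by simp [map_id_derivation_mul])
    (fun P => by
      simp only [tildeOp_series, LinearMap.comp_apply, AlgEquiv.toLinearMap_apply, phiFrame_series,
        TensorProduct.map_tmul, LinearMap.id_apply, Derivation.coeFn_coe]
      rw [AlgEquiv.eq_symm_apply, phiFrame_series])
    (fun l => by
      simp only [LinearMap.comp_apply, AlgEquiv.toLinearMap_apply]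
      rw [AlgEquiv.eq_symm_apply, tildeOp_form, phiFrame_form]
      have h1 : ∀ (p : Fin n) (Q : SHat k n), phiFrame hφ (ExteriorAlgebra.ι k (b p) ⊗ₜ Q) =
          ∑ j, ExteriorAlgebra.ι k (b j) ⊗ₜ (phiMatrix b φ j p * Q) := by
        intro p Q
        have : (ExteriorAlgebra.ι k (b p) ⊗ₜ Q : FormSeries k g n) =
          (ExteriorAlgebra.ι k (b p) ⊗ₜ 1) * (1 ⊗ₜ Q) := by simp
        rw [this, map_mul, phiFrame_form, phiFrame_series]
        simp [Finset.sum_mul]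
      -- The gauge identity: the factor φ⁻¹ in the connection matrix cancels against the frame,
      -- leaving the derivative of φ.
      have h2 : phiMatrix b φ * Matrix.of (connCoeff b φ x) = (phiMatrix b φ).map (φ x) := by
        rw [connCoeff_eq, ← Matrix.mul_assoc, Matrix.mul_nonsing_inv _ (isUnit_det_phiMatrix hφ),
          Matrix.one_mul]
      simp only [map_sum, h1, TensorProduct.map_tmul, LinearMap.id_apply, Derivation.coeFn_coe]
      rw [Finset.sum_comm]
      refine Finset.sum_congr rfl fun j _ => ?_
      rw [← TensorProduct.tmul_sum]
      congr 1
      simpa [Matrix.mul_apply] using congrFun (congrFun h2 j) l)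
  rw [h]
  simp

end Frame

/-! ### Realization of g by vector fields in Â_n -/

section Realization

attribute [local instance 100] LieRing.ofAssociativeRing

variable {k g : Type*} [Field k] [LieRing g] [LieAlgebra k g] {n : ℕ}
  (b : Module.Basis (Fin n) k g)

/-- The vector field `∑_j x_j D(∂^j)` in `Â_n`, for a derivation `D` of `Ŝ(g*)`. -/
noncomputable def weylVector (D : Derivation k (SHat k n) (SHat k n)) : WeylHat b :=
  ∑ j, WeylHat.x b j * WeylHat.ofSeries b (D (MvPowerSeries.X j))

theorem weylVector_add (D E : Derivation k (SHat k n) (SHat k n)) :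
    weylVector b (D + E) = weylVector b D + weylVector b E := by
  simp only [weylVector, Derivation.add_apply, map_add, mul_add, Finset.sum_add_distrib]

theorem weylVector_smul (c : k) (D : Derivation k (SHat k n) (SHat k n)) :
    weylVector b (c • D) = c • weylVector b D := by
  simp only [weylVector, Derivation.smul_apply, map_smul, mul_smul_comm, Finset.smul_sum]

/-- `[P, ∑_j x_j D(∂^j)] = D(P)`. -/
theorem ofSeries_mul_weylVector (D : Derivation k (SHat k n) (SHat k n)) (P : SHat k n) :
    WeylHat.ofSeries b P * weylVector b D =
      weylVector b D * WeylHat.ofSeries b P + WeylHat.ofSeries b (D P) := by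
  rw [weylVector, derivation_chain_rule D P, Finset.mul_sum, Finset.sum_mul, map_sum,
    ← Finset.sum_add_distrib]
  refine Finset.sum_congr rfl fun j _ => ?_
  rw [← mul_assoc, WeylHat.ofSeries_mul_x, add_mul, mul_assoc, mul_assoc, ← map_mul, ← map_mul,
    ← map_mul, mul_comm P]

/-- After normal ordering, the terms quadratic in the `x_i` are symmetric in the two factors and
cancel. What remains is ∑_i x_i (E D - D E)(∂^i): brackets are reversed because the `x_j` act from
the right. -/
theorem weylVector_lie (D E : Derivation k (SHat k n) (SHat k n)) :
    weylVector b D * weylVector b E - weylVector b E * weylVector b D = -weylVector b ⁅D, E⁆ := by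
  have h : ∀ D E : Derivation k (SHat k n) (SHat k n), weylVector b D * weylVector b E =
      (∑ i, ∑ j, WeylHat.x b i * WeylHat.x b j *
        WeylHat.ofSeries b (E (MvPowerSeries.X j) * D (MvPowerSeries.X i))) +
      ∑ i, WeylHat.x b i * WeylHat.ofSeries b (E (D (MvPowerSeries.X i))) := by
    intro D E
    rw [weylVector, Finset.sum_mul, ← Finset.sum_add_distrib]
    refine Finset.sum_congr rfl fun i _ => ?_
    rw [mul_assoc, ofSeries_mul_weylVector, mul_add, weylVector, Finset.sum_mul, Finset.mul_sum]
    simp only [mul_assoc, map_mul]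
  rw [h, h, Finset.sum_comm]
  have hs : ∀ i j, WeylHat.x b i * WeylHat.x b j *
        WeylHat.ofSeries b (E (MvPowerSeries.X j) * D (MvPowerSeries.X i)) =
      WeylHat.x b j * WeylHat.x b i *
        WeylHat.ofSeries b (D (MvPowerSeries.X i) * E (MvPowerSeries.X j)) := fun i j => by
    rw [WeylHat.x_mul_x, mul_comm (D _)]
  simp only [hs, add_sub_add_left_eq_sub]
  rw [weylVector, ← Finset.sum_sub_distrib, ← Finset.sum_neg_distrib]
  refine Finset.sum_congr rfl fun i _ => ?_
  rw [Derivation.commutator_apply, map_sub, mul_sub, neg_sub]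

variable (φ : g →ₗ⁅k⁆ Derivation k (SHat k n) (SHat k n))

/-- The realization `x ↦ ∑_j x_j φ(-x)(∂^j)` of `g` in `Â_n`. -/
noncomputable def weylRealization : g →ₗ⁅k⁆ WeylHat b where
  toFun x := weylVector b (φ (-x))
  map_add' x y := by
    rw [neg_add, map_add φ, weylVector_add]
  map_smul' c x := by
    rw [← smul_neg, map_smul φ, weylVector_smul, RingHom.id_apply]
  map_lie' {x y} := by
    -- The sign in φ(-x) compensates the reversal of brackets: it appears twice in the bracket of
    -- the images and once in the image of the bracket.
    rw [LieRing.of_associative_ring_bracket, weylVector_lie, ← LieHom.map_lie, neg_lie, lie_neg,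
      neg_neg, ← neg_one_smul k ⁅x, y⁆, map_smul φ, weylVector_smul, neg_one_smul]

theorem weylRealization_apply (x : g) : weylRealization b φ x = weylVector b (φ (-x)) := rfl

/-- The inclusion of `Λ(g) ⊗ Ŝ(g*)` into `Λ(g) ⊗ Â_n`. -/
noncomputable def formInclusion : FormSeries k g n →ₐ[k] ExteriorAlgebra k g ⊗[k] WeylHat b :=
  Algebra.TensorProduct.map (AlgHom.id k _) (WeylHat.ofSeries b)

theorem formInclusion_tmul (u : ExteriorAlgebra k g) (P : SHat k n) :
    formInclusion b (u ⊗ₜ P) = u ⊗ₜ WeylHat.ofSeries b P := rfl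

theorem formInclusion_injective : Function.Injective (formInclusion b) := by
  have h : Function.Injective (WeylHat.ofSeries b) := Smash.inr_injective _
  exact Module.Flat.lTensor_preserves_injective_linearMap (M := ExteriorAlgebra k g)
    (WeylHat.ofSeries b).toLinearMap h

/-- Vector fields in Â_n commute with Λ(g), so only the coefficients are differentiated. For D =
φ(-x) this is the relation of the smash product, seen in the frame where φ̃ is id ⊗ φ. -/
theorem formInclusion_mul_weylVector (D : Derivation k (SHat k n) (SHat k n))
    (ω : FormSeries k g n) :
    formInclusion b ω * (1 ⊗ₜ weylVector b D) = (1 ⊗ₜ weylVector b D) * formInclusion b ω +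
      formInclusion b (TensorProduct.map LinearMap.id D.toLinearMap ω) := by
  induction ω using TensorProduct.induction_on with
  | zero => simp
  | add ω ω' h h' => simp only [add_mul, mul_add, map_add, h, h']; abel
  | tmul u P =>
    simp [formInclusion_tmul, ofSeries_mul_weylVector, TensorProduct.tmul_add]

end Realization

/-! ### Commutators in the algebra of twisted forms -/

section Isomorphism

attribute [local instance 100] LieRing.ofAssociativeRing

variable {k g : Type*} [Field k] [LieRing g] [LieAlgebra k g] {n : ℕ}
  {b : Module.Basis (Fin n) k g}
  {φ : g →ₗ⁅k⁆ Derivation k (SHat k n) (SHat k n)}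

theorem rightActionU_act_ι {A : Type*} [Ring A] [Algebra k A] (ψ : g →ₗ⁅k⁆ Module.End k A)
    (hψ : ∀ x a b, ψ x (a * b) = ψ x a * b + a * ψ x b) (a : A) (x : g) :
    (rightActionU ψ hψ).act a (UniversalEnvelopingAlgebra.ι k x) = ψ (-x) a := by
  have h : (AlgHom.op (UniversalEnvelopingAlgebra.lift k ψ)).comp (antipodeU k g)
      (UniversalEnvelopingAlgebra.ι k x) = MulOpposite.op (ψ (-x)) := by
    rw [AlgHom.comp_apply, antipodeU_ι, ← UniversalEnvelopingAlgebra.lift_ι_apply k ψ (-x),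
      map_neg (UniversalEnvelopingAlgebra.ι k) x]
    rfl
  rw [RightHopfAction.act_apply]
  change ((AlgHom.op (UniversalEnvelopingAlgebra.lift k ψ)).comp (antipodeU k g)
      (UniversalEnvelopingAlgebra.ι k x)).unop a = _
  rw [h]
  rfl

theorem twistedAction_act_ι (hφ : CloseToIdentity b φ) (ω : FormSeries k g n) (x : g) :
    (twistedAction hφ).act ω (UniversalEnvelopingAlgebra.ι k x) = tildeOp b φ (-x) ω :=
  rightActionU_act_ι _ _ ω x

theorem TwistedAlg.inr_mul_inl_ι (hφ : CloseToIdentity b φ) (ω : FormSeries k g n) (x : g) :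
    Smash.inr (twistedAction hφ) ω *
        Smash.inl (twistedAction hφ) (UniversalEnvelopingAlgebra.ι k x) =
      Smash.inl (twistedAction hφ) (UniversalEnvelopingAlgebra.ι k x) *
        Smash.inr (twistedAction hφ) ω + Smash.inr (twistedAction hφ) (tildeOp b φ (-x) ω) := by
  rw [Smash.inr_mul_inl_of_primitive _ (comulU_ι k g x), twistedAction_act_ι]

theorem TwistedAlg.algHom_ext {B : Type*} [Ring B] [Algebra k B] (hφ : CloseToIdentity b φ)
    {F F' : TwistedAlg hφ →ₐ[k] B} (hx : ∀ i, F (TwistedAlg.x hφ i) = F' (TwistedAlg.x hφ i))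
    (hr : F.comp (Smash.inr _) = F'.comp (Smash.inr _)) : F = F' := by
  refine Smash.algHom_ext _ (algHomU_ext k g fun x => ?_) hr
  exact LinearMap.congr_fun (b.ext (f₁ := (F.comp (Smash.inl _)).toLinearMap ∘ₗ
    (UniversalEnvelopingAlgebra.ι k : g →ₗ⁅k⁆ _).toLinearMap)
    (f₂ := (F'.comp (Smash.inl _)).toLinearMap ∘ₗ
    (UniversalEnvelopingAlgebra.ι k : g →ₗ⁅k⁆ _).toLinearMap) hx) x

/-- The inclusion of the power series in the algebra of twisted forms. -/
noncomputable def TwistedAlg.ofSeries (hφ : CloseToIdentity b φ) : SHat k n →ₐ[k] TwistedAlg hφ :=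
  (Smash.inr (twistedAction hφ)).comp Algebra.TensorProduct.includeRight

theorem TwistedAlg.ofSeries_apply (hφ : CloseToIdentity b φ) (P : SHat k n) :
    TwistedAlg.ofSeries hφ P = Smash.inr (twistedAction hφ) (1 ⊗ₜ P) := rfl

theorem TwistedAlg.ofSeries_mul_x (hφ : CloseToIdentity b φ) (P : SHat k n) (i : Fin n) :
    TwistedAlg.ofSeries hφ P * TwistedAlg.x hφ i =
      TwistedAlg.x hφ i * TwistedAlg.ofSeries hφ P + TwistedAlg.ofSeries hφ (φ (-b i) P) := by
  rw [TwistedAlg.ofSeries_apply, TwistedAlg.x, TwistedAlg.inr_mul_inl_ι, tildeOp_series]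
  rfl

/-- The linear map `Q ↦ ∑_i x̂_i Q_i`. -/
noncomputable def TwistedAlg.vector (hφ : CloseToIdentity b φ) :
    (Fin n → SHat k n) →ₗ[k] TwistedAlg hφ :=
  ∑ i, LinearMap.mulLeft k (TwistedAlg.x hφ i) ∘ₗ (TwistedAlg.ofSeries hφ).toLinearMap ∘ₗ
    LinearMap.proj i

theorem TwistedAlg.vector_apply (hφ : CloseToIdentity b φ) (Q : Fin n → SHat k n) :
    TwistedAlg.vector hφ Q = ∑ i, TwistedAlg.x hφ i * TwistedAlg.ofSeries hφ (Q i) := by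
  simp [TwistedAlg.vector]

theorem TwistedAlg.inl_ι_mul_ofSeries (hφ : CloseToIdentity b φ) (y : g) (P : SHat k n) :
    Smash.inl (twistedAction hφ) (UniversalEnvelopingAlgebra.ι k y) * TwistedAlg.ofSeries hφ P =
      TwistedAlg.vector hφ fun i => b.repr y i • P := by
  conv_lhs => rw [← b.sum_repr y]
  simp only [TwistedAlg.vector_apply, map_sum, map_smul, Finset.sum_mul, smul_mul_assoc,
    mul_smul_comm]
  rfl

theorem TwistedAlg.x_mul_ofSeries_mem (hφ : CloseToIdentity b φ) (i : Fin n) (P : SHat k n) :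
    TwistedAlg.x hφ i * TwistedAlg.ofSeries hφ P ∈ LinearMap.range (TwistedAlg.vector hφ) := by
  rw [TwistedAlg.x, TwistedAlg.inl_ι_mul_ofSeries]
  exact LinearMap.mem_range_self _ _

/-- Series commute, so both quadratic terms carry the same coefficient `P * P'` and combine to
[x̂_i, x̂_j] `P * P'`, which is linear in the x̂'s because g is closed under the bracket. The terms
from moving a series past an x̂ are linear already. -/
theorem TwistedAlg.commutator_x_mul_ofSeries_mem (hφ : CloseToIdentity b φ) (i j : Fin n)
    (P P' : SHat k n) :
    (TwistedAlg.x hφ i * TwistedAlg.ofSeries hφ P) *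
        (TwistedAlg.x hφ j * TwistedAlg.ofSeries hφ P') -
      (TwistedAlg.x hφ j * TwistedAlg.ofSeries hφ P') *
        (TwistedAlg.x hφ i * TwistedAlg.ofSeries hφ P) ∈
          LinearMap.range (TwistedAlg.vector hφ) := by
  have h1 : ∀ (i j : Fin n) (P P' : SHat k n),
      (TwistedAlg.x hφ i * TwistedAlg.ofSeries hφ P) *
        (TwistedAlg.x hφ j * TwistedAlg.ofSeries hφ P') =
      TwistedAlg.x hφ i * TwistedAlg.x hφ j * TwistedAlg.ofSeries hφ (P * P') +
        TwistedAlg.x hφ i * TwistedAlg.ofSeries hφ (φ (-b j) P * P') := by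
    intro i j P P'
    rw [mul_assoc, ← mul_assoc (TwistedAlg.ofSeries hφ P), TwistedAlg.ofSeries_mul_x, add_mul,
      mul_add, map_mul, map_mul]
    simp only [mul_assoc]
  have h2 : TwistedAlg.x hφ i * TwistedAlg.x hφ j - TwistedAlg.x hφ j * TwistedAlg.x hφ i =
      Smash.inl (twistedAction hφ) (UniversalEnvelopingAlgebra.ι k ⁅b i, b j⁆) := by
    rw [LieHom.map_lie, LieRing.of_associative_ring_bracket, map_sub, map_mul, map_mul]
    rfl
  rw [h1, h1, mul_comm P' P, add_sub_add_comm, ← sub_mul, h2, TwistedAlg.inl_ι_mul_ofSeries]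
  exact add_mem (LinearMap.mem_range_self _ _)
    (sub_mem (TwistedAlg.x_mul_ofSeries_mem hφ _ _) (TwistedAlg.x_mul_ofSeries_mem hφ _ _))

theorem sum_commutator_sum {R ι : Type*} [Ring R] [Fintype ι] (p q : ι → R) :
    (∑ i, p i) * (∑ j, q j) - (∑ j, q j) * (∑ i, p i) =
      ∑ i, ∑ j, (p i * q j - q j * p i) := by
  simp only [Finset.sum_sub_distrib, Finset.sum_mul_sum]
  congr 1
  exact Finset.sum_comm

theorem TwistedAlg.commutator_mem (hφ : CloseToIdentity b φ) (Q R : Fin n → SHat k n) :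
    TwistedAlg.vector hφ Q * TwistedAlg.vector hφ R -
      TwistedAlg.vector hφ R * TwistedAlg.vector hφ Q ∈
        LinearMap.range (TwistedAlg.vector hφ) := by
  rw [TwistedAlg.vector_apply, TwistedAlg.vector_apply, sum_commutator_sum]
  exact sum_mem fun i _ => sum_mem fun j _ =>
    TwistedAlg.commutator_x_mul_ofSeries_mem hφ i j _ _

/-- The element `∑_i x̂_i (φ⁻¹)^i_a` of the algebra of twisted forms. -/
noncomputable def TwistedAlg.flatX (hφ : CloseToIdentity b φ) (a : Fin n) : TwistedAlg hφ :=
  TwistedAlg.vector hφ fun i => (phiMatrix b φ)⁻¹ i a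

/-- A commutator of a form with `∑_i x̂_i (φ⁻¹)^i_a` is a form. -/
theorem TwistedAlg.exists_inr_commutator_flatX (hφ : CloseToIdentity b φ)
    (ω : FormSeries k g n) (a : Fin n) : ∃ η, Smash.inr (twistedAction hφ) η =
      Smash.inr (twistedAction hφ) ω * TwistedAlg.flatX hφ a -
        TwistedAlg.flatX hφ a * Smash.inr (twistedAction hφ) ω := by
  -- Only the x̂_i contribute to the commutator, each with φ̃(-x̂_i)(ω); their coefficients commute
  -- with all forms.
  refine ⟨∑ i, tildeOp b φ (-b i) ω * (1 ⊗ₜ (phiMatrix b φ)⁻¹ i a), ?_⟩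
  rw [TwistedAlg.flatX, TwistedAlg.vector_apply, Finset.mul_sum, Finset.sum_mul,
    ← Finset.sum_sub_distrib, map_sum]
  refine Finset.sum_congr rfl fun i _ => ?_
  rw [TwistedAlg.ofSeries_apply, TwistedAlg.x, ← mul_assoc, TwistedAlg.inr_mul_inl_ι, add_mul,
    mul_assoc, mul_assoc, ← map_mul, ← map_mul, ← map_mul, (commute_one_tmul ω _).eq,
    add_sub_cancel_left]

/-! ### The homomorphism to Λ(g) ⊗ Â_n and the relations it reflects -/

variable [CharZero k]

/-- The homomorphism `x̂_i ↦ ∑_j x_j φ^j_i`, `∂^i ↦ ∂^i`, `dx̂_i ↦ ∑_j dx_j φ^j_i`. -/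
noncomputable def toWeylForms (hφ : CloseToIdentity b φ) :
    TwistedAlg hφ →ₐ[k] ExteriorAlgebra k g ⊗[k] WeylHat b :=
  Smash.liftPrimitive (twistedAction hφ)
    (Algebra.TensorProduct.includeRight.comp
      (UniversalEnvelopingAlgebra.lift k (weylRealization b φ)))
    ((formInclusion b).comp (phiFrame hφ).toAlgHom) (adjoin_range_ιU k g)
    (by rintro _ ⟨x, rfl⟩; exact comulU_ι k g x)
    (by
      rintro _ ⟨x, rfl⟩ ω
      rw [twistedAction_act_ι, AlgHom.comp_apply, AlgHom.comp_apply, AlgHom.comp_apply,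
        UniversalEnvelopingAlgebra.lift_ι_apply, weylRealization_apply]
      refine (formInclusion_mul_weylVector b _ _).trans ?_
      congr 2
      exact (phiFrame_tildeOp hφ _ _).symm)

theorem toWeylForms_inl_ι (hφ : CloseToIdentity b φ) (x : g) :
    toWeylForms hφ (Smash.inl _ (UniversalEnvelopingAlgebra.ι k x)) =
      1 ⊗ₜ weylVector b (φ (-x)) := by
  rw [toWeylForms, Smash.liftPrimitive_inl, AlgHom.comp_apply,
    UniversalEnvelopingAlgebra.lift_ι_apply]
  rfl

theorem toWeylForms_inr (hφ : CloseToIdentity b φ) (ω : FormSeries k g n) :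
    toWeylForms hφ (Smash.inr _ ω) = formInclusion b (phiFrame hφ ω) := by
  rw [toWeylForms, Smash.liftPrimitive_inr]
  rfl

theorem toWeylForms_x (hφ : CloseToIdentity b φ) (i : Fin n) :
    toWeylForms hφ (TwistedAlg.x hφ i) =
      ∑ j, 1 ⊗ₜ[k] (WeylHat.x b j * WeylHat.ofSeries b (phiMatrix b φ j i)) := by
  rw [TwistedAlg.x, toWeylForms_inl_ι, weylVector, TensorProduct.tmul_sum]
  rfl

theorem toWeylForms_ofSeries (hφ : CloseToIdentity b φ) (P : SHat k n) :
    toWeylForms hφ (TwistedAlg.ofSeries hφ P) = 1 ⊗ₜ[k] WeylHat.ofSeries b P := by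
  rw [TwistedAlg.ofSeries_apply, toWeylForms_inr, phiFrame_series, formInclusion_tmul]

theorem toWeylForms_dx (hφ : CloseToIdentity b φ) (i : Fin n) :
    toWeylForms hφ (TwistedAlg.dx hφ i) =
      ∑ j, ExteriorAlgebra.ι k (b j) ⊗ₜ[k] WeylHat.ofSeries b (phiMatrix b φ j i) := by
  rw [TwistedAlg.dx, toWeylForms_inr, phiFrame_form, map_sum]
  rfl

theorem toWeylForms_inr_injective (hφ : CloseToIdentity b φ) {ω : FormSeries k g n}
    (h : toWeylForms hφ (Smash.inr _ ω) = 0) : ω = 0 := by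
  rw [toWeylForms_inr, map_eq_zero_iff _ (formInclusion_injective b)] at h
  exact (phiFrame hφ).map_eq_zero_iff.1 h

theorem toWeylForms_vector (hφ : CloseToIdentity b φ) (Q : Fin n → SHat k n) :
    toWeylForms hφ (TwistedAlg.vector hφ Q) =
      1 ⊗ₜ ∑ j, WeylHat.x b j * WeylHat.ofSeries b ((phiMatrix b φ).mulVec Q j) := by
  simp only [TwistedAlg.vector_apply, map_sum, map_mul, toWeylForms_x, toWeylForms_ofSeries,
    Finset.sum_mul, Algebra.TensorProduct.tmul_mul_tmul, one_mul, Matrix.mulVec, dotProduct,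
    Finset.mul_sum, TensorProduct.tmul_sum, mul_assoc]
  rw [Finset.sum_comm]

/-- The image is linear in the `x_j` with coefficient vector φ Q, so its vanishing gives φ Q = 0,
and φ is invertible. -/
theorem toWeylForms_vector_injective (hφ : CloseToIdentity b φ) {Q : Fin n → SHat k n}
    (h : toWeylForms hφ (TwistedAlg.vector hφ Q) = 0) : Q = 0 := by
  rw [toWeylForms_vector] at h
  have hi : Function.Injective (Algebra.TensorProduct.includeRight :
      WeylHat b →ₐ[k] ExteriorAlgebra k g ⊗[k] WeylHat b) :=
    Algebra.TensorProduct.includeRight_injective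
      (FaithfulSMul.algebraMap_injective k (ExteriorAlgebra k g))
  have h0 := WeylHat.eq_zero_of_sum_x_mul_ofSeries b
    (hi (h.trans (map_zero Algebra.TensorProduct.includeRight).symm))
  have h1 : (phiMatrix b φ).mulVec Q = 0 := h0
  rw [← Matrix.one_mulVec Q, ← Matrix.nonsing_inv_mul _ (isUnit_det_phiMatrix hφ),
    ← Matrix.mulVec_mulVec, h1, Matrix.mulVec_zero]

theorem toWeylForms_flatX (hφ : CloseToIdentity b φ) (a : Fin n) :
    toWeylForms hφ (TwistedAlg.flatX hφ a) = 1 ⊗ₜ WeylHat.x b a := by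
  classical
  have h : ∀ j, (phiMatrix b φ).mulVec (fun i => (phiMatrix b φ)⁻¹ i a) j =
      if j = a then 1 else 0 := fun j => by
    rw [← Matrix.one_apply, ← Matrix.mul_nonsing_inv _ (isUnit_det_phiMatrix hφ)]
    rfl
  rw [TwistedAlg.flatX, toWeylForms_vector]
  congr 1
  rw [Finset.sum_eq_single a (fun j _ hj => by rw [h, if_neg hj, map_zero, mul_zero])
    (fun h => absurd (Finset.mem_univ a) h), h, if_pos rfl, map_one, mul_one]

/-- The commutator has the form ∑_i x̂_i Q_i and is sent to [x_a, x_c] = 0; on elements of this form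
the homomorphism is injective. -/
theorem TwistedAlg.flatX_mul_flatX (hφ : CloseToIdentity b φ) (a c : Fin n) :
    TwistedAlg.flatX hφ a * TwistedAlg.flatX hφ c =
      TwistedAlg.flatX hφ c * TwistedAlg.flatX hφ a := by
  obtain ⟨Q, hQ⟩ := TwistedAlg.commutator_mem hφ (fun i => (phiMatrix b φ)⁻¹ i a)
    (fun i => (phiMatrix b φ)⁻¹ i c)
  change _ = TwistedAlg.flatX hφ a * TwistedAlg.flatX hφ c -
      TwistedAlg.flatX hφ c * TwistedAlg.flatX hφ a at hQ
  rw [← sub_eq_zero, ← hQ]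
  have h0 : toWeylForms hφ (TwistedAlg.vector hφ Q) = 0 := by
    rw [hQ, map_sub, map_mul, map_mul, toWeylForms_flatX, toWeylForms_flatX,
      Algebra.TensorProduct.tmul_mul_tmul, Algebra.TensorProduct.tmul_mul_tmul,
      WeylHat.x_mul_x, sub_self]
  rw [toWeylForms_vector_injective hφ h0, map_zero]

/-- If the image of a commutator of a form with `∑_i x̂_i (φ⁻¹)^i_a` is that of a form, then
the commutator is this form. -/
theorem TwistedAlg.inr_mul_flatX (hφ : CloseToIdentity b φ) {ω η : FormSeries k g n} {a : Fin n}
    (h : formInclusion b (phiFrame hφ ω) * (1 ⊗ₜ WeylHat.x b a) =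
      (1 ⊗ₜ WeylHat.x b a) * formInclusion b (phiFrame hφ ω) + formInclusion b (phiFrame hφ η)) :
    Smash.inr (twistedAction hφ) ω * TwistedAlg.flatX hφ a =
      TwistedAlg.flatX hφ a * Smash.inr (twistedAction hφ) ω + Smash.inr (twistedAction hφ) η := by
  obtain ⟨ζ, hζ⟩ := TwistedAlg.exists_inr_commutator_flatX hφ ω a
  have h0 : toWeylForms hφ (Smash.inr _ (ζ - η)) = 0 := by
    rw [map_sub, map_sub, hζ, map_sub, map_mul, map_mul, toWeylForms_flatX, toWeylForms_inr,
      toWeylForms_inr, h, add_sub_cancel_left, sub_self]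
  rw [← sub_eq_zero.1 (toWeylForms_inr_injective hφ h0), hζ, add_sub_cancel]

theorem TwistedAlg.ofSeries_mul_flatX (hφ : CloseToIdentity b φ) (P : SHat k n) (a : Fin n) :
    TwistedAlg.ofSeries hφ P * TwistedAlg.flatX hφ a =
      TwistedAlg.flatX hφ a * TwistedAlg.ofSeries hφ P +
        TwistedAlg.ofSeries hφ (MvPowerSeries.pderiv k a P) := by
  refine TwistedAlg.inr_mul_flatX hφ (ω := 1 ⊗ₜ P) (η := 1 ⊗ₜ MvPowerSeries.pderiv k a P) ?_
  simp only [phiFrame_series, formInclusion_tmul, Algebra.TensorProduct.tmul_mul_tmul, mul_one,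
    WeylHat.ofSeries_mul_x, TensorProduct.tmul_add]

/-! ### The inverse homomorphism -/

/-- The homomorphism `x_a ↦ ∑_i x̂_i (φ⁻¹)^i_a`, `∂^i ↦ ∂^i`. -/
noncomputable def ofWeyl (hφ : CloseToIdentity b φ) : WeylHat b →ₐ[k] TwistedAlg hφ :=
  Smash.liftPrimitive (weylAction b)
    (liftSym (b.constr k (TwistedAlg.flatX hφ)) fun x y => by
      simp only [Module.Basis.constr_apply_fintype, Finset.sum_mul_sum, smul_mul_smul_comm]
      rw [Finset.sum_comm]
      refine Finset.sum_congr rfl fun i _ => Finset.sum_congr rfl fun j _ => ?_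
      rw [TwistedAlg.flatX_mul_flatX, mul_comm])
    (TwistedAlg.ofSeries hφ) adjoin_range_ιSym
    (by rintro _ ⟨x, rfl⟩; exact SymmetricAlgebra.comul_ι k g x)
    (by
      rintro _ ⟨x, rfl⟩ P
      rw [liftSym_ι, weylAction_act_ι, Module.Basis.constr_apply_fintype, Finset.mul_sum,
        Finset.sum_mul, map_sum, ← Finset.sum_add_distrib]
      refine Finset.sum_congr rfl fun a _ => ?_
      rw [mul_smul_comm, TwistedAlg.ofSeries_mul_flatX, smul_add, smul_mul_assoc, map_smul]
      rfl)

theorem ofWeyl_x (hφ : CloseToIdentity b φ) (a : Fin n) :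
    ofWeyl hφ (WeylHat.x b a) = TwistedAlg.flatX hφ a := by
  rw [ofWeyl, WeylHat.x, Smash.liftPrimitive_inl, liftSym_ι, Module.Basis.constr_basis]

theorem ofWeyl_ofSeries (hφ : CloseToIdentity b φ) (P : SHat k n) :
    ofWeyl hφ (WeylHat.ofSeries b P) = TwistedAlg.ofSeries hφ P := by
  rw [ofWeyl, WeylHat.ofSeries, Smash.liftPrimitive_inr]

/-- The embedding `dx_l ↦ ∑_j dx̂_j (φ⁻¹)^j_l` of `Λ(g)`. -/
noncomputable def ofExterior (hφ : CloseToIdentity b φ) :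
    ExteriorAlgebra k g →ₐ[k] TwistedAlg hφ :=
  ((Smash.inr (twistedAction hφ)).comp (phiFrame hφ).symm.toAlgHom).comp
    Algebra.TensorProduct.includeLeft

theorem ofExterior_apply (hφ : CloseToIdentity b φ) (u : ExteriorAlgebra k g) :
    ofExterior hφ u = Smash.inr _ ((phiFrame hφ).symm (u ⊗ₜ 1)) := rfl

theorem ofExterior_commute (hφ : CloseToIdentity b φ) (u : ExteriorAlgebra k g) (w : WeylHat b) :
    Commute (ofExterior hφ u) (ofWeyl hφ w) := by
  refine WeylHat.commute_of_generators b _ (fun j => ?_) (fun P => ?_) w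
  · rw [ofWeyl_x, ofExterior_apply]
    -- In the target, `u ⊗ 1` commutes with `1 ⊗ x_j`, so the form that the commutator must equal is
    -- zero.
    have := TwistedAlg.inr_mul_flatX hφ (ω := (phiFrame hφ).symm (u ⊗ₜ 1)) (η := 0) (a := j)
      (by simp [formInclusion_tmul])
    rwa [map_zero, add_zero] at this
  · rw [ofWeyl_ofSeries, ofExterior_apply, TwistedAlg.ofSeries_apply]
    exact (commute_one_tmul _ P).map _

/-- The homomorphism inverse to `toWeylForms`. -/
noncomputable def ofWeylForms (hφ : CloseToIdentity b φ) :
    ExteriorAlgebra k g ⊗[k] WeylHat b →ₐ[k] TwistedAlg hφ :=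
  Algebra.TensorProduct.lift (ofExterior hφ) (ofWeyl hφ) (ofExterior_commute hφ)

theorem ofWeylForms_tmul (hφ : CloseToIdentity b φ) (u : ExteriorAlgebra k g) (w : WeylHat b) :
    ofWeylForms hφ (u ⊗ₜ w) = ofExterior hφ u * ofWeyl hφ w :=
  Algebra.TensorProduct.lift_tmul _ _ _ _ _

theorem toWeylForms_comp_ofWeylForms (hφ : CloseToIdentity b φ) :
    (toWeylForms hφ).comp (ofWeylForms hφ) = AlgHom.id k _ := by
  refine Algebra.TensorProduct.ext (AlgHom.ext fun u => ?_)
    (WeylHat.algHom_ext b (fun j => ?_) fun P => ?_)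
  · change toWeylForms hφ (ofWeylForms hφ (u ⊗ₜ 1)) = u ⊗ₜ 1
    rw [ofWeylForms_tmul, map_one, mul_one, ofExterior_apply, toWeylForms_inr,
      AlgEquiv.apply_symm_apply, formInclusion_tmul, map_one]
  · change toWeylForms hφ (ofWeylForms hφ (1 ⊗ₜ WeylHat.x b j)) = 1 ⊗ₜ WeylHat.x b j
    rw [ofWeylForms_tmul, map_one, one_mul, ofWeyl_x, toWeylForms_flatX]
  · change toWeylForms hφ (ofWeylForms hφ (1 ⊗ₜ WeylHat.ofSeries b P)) = 1 ⊗ₜ WeylHat.ofSeries b P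
    rw [ofWeylForms_tmul, map_one, one_mul, ofWeyl_ofSeries, toWeylForms_ofSeries]

theorem ofWeylForms_formInclusion (hφ : CloseToIdentity b φ) (ω : FormSeries k g n) :
    ofWeylForms hφ (formInclusion b ω) = Smash.inr _ ((phiFrame hφ).symm ω) := by
  have h : (ofWeylForms hφ).comp (formInclusion b) =
      (Smash.inr (twistedAction hφ)).comp (phiFrame hφ).symm.toAlgHom := by
    refine formSeries_algHom_ext b (fun P => ?_) fun l => ?_
    · change ofWeylForms hφ (1 ⊗ₜ WeylHat.ofSeries b P) =
        Smash.inr _ ((phiFrame hφ).symm (1 ⊗ₜ P))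
      rw [ofWeylForms_tmul, map_one, one_mul, ofWeyl_ofSeries, TwistedAlg.ofSeries_apply,
        (phiFrame hφ).symm_apply_eq.2 (phiFrame_series hφ P).symm]
    · change ofWeylForms hφ (formInclusion b (_ ⊗ₜ 1)) = Smash.inr _ ((phiFrame hφ).symm (_ ⊗ₜ 1))
      rw [formInclusion_tmul, map_one, ofWeylForms_tmul, map_one, mul_one, ofExterior_apply]
  exact DFunLike.congr_fun h ω

theorem ofWeylForms_comp_toWeylForms (hφ : CloseToIdentity b φ) :
    (ofWeylForms hφ).comp (toWeylForms hφ) = AlgHom.id k _ := by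
  classical
  refine TwistedAlg.algHom_ext hφ (fun i => ?_) (AlgHom.ext fun ω => ?_)
  · rw [AlgHom.comp_apply, toWeylForms_x, map_sum, AlgHom.id_apply]
    simp only [ofWeylForms_tmul, map_one, one_mul, map_mul, ofWeyl_x, ofWeyl_ofSeries,
      TwistedAlg.flatX, TwistedAlg.vector_apply, Finset.sum_mul, mul_assoc]
    simp only [← map_mul]
    rw [Finset.sum_comm]
    -- The coefficient of each x̂ is now an entry of φ⁻¹ φ = 1 in column `i`.
    simp only [← Finset.mul_sum, ← map_sum, ← Matrix.mul_apply,
      Matrix.nonsing_inv_mul _ (isUnit_det_phiMatrix hφ)]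
    rw [Finset.sum_eq_single i (fun j _ hj => by
        rw [Matrix.one_apply_ne hj, map_zero, mul_zero])
      (fun h => absurd (Finset.mem_univ i) h), Matrix.one_apply_eq, map_one, mul_one]
  · change ofWeylForms hφ (toWeylForms hφ (Smash.inr _ ω)) = Smash.inr _ ω
    rw [toWeylForms_inr, ofWeylForms_formInclusion, AlgEquiv.symm_apply_apply]

/-- The algebra of twisted forms is isomorphic to `Λ(g) ⊗ Â_n`. -/
noncomputable def weylFormsEquiv (hφ : CloseToIdentity b φ) :
    TwistedAlg hφ ≃ₐ[k] ExteriorAlgebra k g ⊗[k] WeylHat b :=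
  AlgEquiv.ofAlgHom (toWeylForms hφ) (ofWeylForms hφ) (toWeylForms_comp_ofWeylForms hφ)
    (ofWeylForms_comp_toWeylForms hφ)

end Isomorphism

end TwistedForms

theorem theorem2p3 {k g : Type*} [Field k] [CharZero k] [LieRing g] [LieAlgebra k g] {n : ℕ}
    (b : Module.Basis (Fin n) k g)
    (φ : g →ₗ⁅k⁆ Derivation k (SHat k n) (SHat k n))
    (hφ : CloseToIdentity b φ) :
    ∃ Ψ : TwistedAlg hφ ≃ₐ[k] ExteriorAlgebra k g ⊗[k] WeylHat b,
      ((∀ i, Ψ (TwistedAlg.x hφ i) =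
          ∑ j, 1 ⊗ₜ[k] (WeylHat.x b j * WeylHat.ofSeries b (phiMatrix b φ j i))) ∧
        (∀ i, Ψ (TwistedAlg.del hφ i) = 1 ⊗ₜ[k] WeylHat.del b i) ∧
        (∀ i, Ψ (TwistedAlg.dx hφ i) =
          ∑ j, ExteriorAlgebra.ι k (b j) ⊗ₜ[k] WeylHat.ofSeries b (phiMatrix b φ j i))) ∧
      ∀ F : TwistedAlg hφ →ₐ[k] ExteriorAlgebra k g ⊗[k] WeylHat b,
        (∀ i, F (TwistedAlg.x hφ i) =
          ∑ j, 1 ⊗ₜ[k] (WeylHat.x b j * WeylHat.ofSeries b (phiMatrix b φ j i))) →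
        (∀ i, F (TwistedAlg.del hφ i) = 1 ⊗ₜ[k] WeylHat.del b i) →
        (∀ i, F (TwistedAlg.dx hφ i) =
          ∑ j, ExteriorAlgebra.ι k (b j) ⊗ₜ[k] WeylHat.ofSeries b (phiMatrix b φ j i)) →
        F = Ψ := by
  refine ⟨weylFormsEquiv hφ, ⟨toWeylForms_x hφ, fun i => toWeylForms_ofSeries hφ _,
    toWeylForms_dx hφ⟩, fun F hx hdel hdx => ?_⟩
  refine TwistedAlg.algHom_ext hφ (fun i => (hx i).trans (toWeylForms_x hφ i).symm)
    (formSeries_algHom_ext b (fun P => ?_) fun l => (hdx l).trans (toWeylForms_dx hφ l).symm)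
  -- The values on the `∂^i` alone determine `F` on every series, by separatedness instead of
  -- continuity.
  exact (algHom_series_eq b (F.comp (TwistedAlg.ofSeries hφ)) hdel P).trans
    (toWeylForms_ofSeries hφ P).symm
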